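/- Let $\mathcal X$ be a finite set, $K:\mathcal X\times\mathcal X\to[0,\infty)$ an irreducible Markov kernel with invariant probability distribution $\varpi$, and assume that $K$ is reversible: $K(x,y)\varpi(x)=K(y,x)\varpi(y)$ for all $x,y\in\mathcal X$. Let $\mathcal M=\{\mu:\mathcal X\to\mathbb R \mid \mu(x)\ge 0 \text{ for all } x\in\mathcal X\}$, fix $a,b>0$, and fix $p:\mathcal X\to(0,\infty)$ with $\sum_{x}\varpi(x)p(x)=1$. For $u,v\ge 0$ let $\theta(u,v)=\int_0^1u^{\xi}v^{1-\xi}\,d\xi$ be the logarithmic mean, i.e. $\theta(u,v)=\frac{u-v}{\log u-\log v}$ if $u\ne v$ and $u,v>0$, $\theta(u,u)=u$, and $\theta(u,v)=0$ if $u=0$ or $v=0$; for $\mu\in\mathcal M$ put $\hat\mu(x,y)=\theta(\mu(x),\mu(y))$. For $\mu_0,\mu_1\in\mathcal M$ let $\mathrm{CE}_p(\mu_0,\mu_1)$ be the set of all triples $(\mu_t,\psi_t,h_t)_{t\in[0,1]}$ such that $t\mapsto\mu_t\in\mathcal M$ is absolutely continuous on $[0,1]$, equals $\mu_0$ at $t=0$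 and $\mu_1$ at $t=1$, the maps $\psi:[0,1]\to\mathbb R^{\mathcal X}$ and $h:[0,1]\to\mathbb R$ are measurable, and for a.e. $t\in[0,1]$ and all $x\in\mathcal X$ $$\dot\mu_t(x)+\sum_{y\in\mathcal X}\big(\psi_t(y)-\psi_t(x)\big)\hat\mu_t(x,y)K(x,y)=h_t\,p(x).$$ Define the action (with values in $[0,\infty]$) $$E^{a,b}_{\rm Quad}\big((\mu_t,\psi_t,h_t)_{t\in[0,1]}\big)=a^2\int_0^1h_t^2\,dt+b^2\int_0^1\frac12\sum_{x,y\in\mathcal X}\big(\psi_t(y)-\psi_t(x)\big)^2\hat\mu_t(x,y)K(x,y)\varpi(x)\,dt$$ and let $\mathcal W^{a,b}_p(\mu_0,\mu_1)\in[0,\infty]$ be the square root of the infimum of $E^{a,b}_{\rm Quad}$ over $\mathrm{CE}_p(\mu_0,\mu_1)$. Then for any $\mu_0,\mu_1\in\mathcal M$ one has $\mathcal W^{a,b}_p(\mu_0,\mu_1)<\infty$, and there exists a triple $(\mu_t,\psi_t,h_t)_{t\in[0,1]}\in\mathrm{CE}_p(\mu_0,\mu_1)$ with $$E^{a,b}_{\rm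 Quad}\big((\mu_t,\psi_t,h_t)_{t\in[0,1]}\big)=\mathcal W^{a,b}_p(\mu_0,\mu_1)^2,$$ that is, the infimum defining $\mathcal W^{a,b}_p(\mu_0,\mu_1)^2$ is attained. -/

import Mathlib

open Set MeasureTheory
open scoped ENNReal

noncomputable section

namespace MarkovTransport

/-- `K` is an irreducible Markov kernel on the finite set `X` (nonnegativity of the entries is part of
`Matrix.IsIrreducible`) and `ϖ` is an invariant probability distribution for which `K` is
reversible. -/
structure IsReversibleChain {X : Type*} [Fintype X] (K : Matrix X X ℝ) (ϖ : X → ℝ) : Prop where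
  irreducible : K.IsIrreducible
  row_sum : ∀ x, ∑ y, K x y = 1
  nonneg : ∀ x, 0 ≤ ϖ x
  sum_eq_one : ∑ x, ϖ x = 1
  invariant : ∀ x, ϖ x = ∑ y, ϖ y * K y x
  reversible : ∀ x y, K x y * ϖ x = K y x * ϖ y

/-- The cone of nonnegative densities on `X`. -/
def densities (X : Type*) : Set (X → ℝ) := {μ | ∀ x, 0 ≤ μ x}

/-- The strictly positive densities on `X`. -/
def posDensities (X : Type*) : Set (X → ℝ) := {μ | ∀ x, 0 < μ x}

/-- The total mass `∑ x, ϖ x * |ψ x|`. -/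
def mass {X : Type*} [Fintype X] (ϖ ψ : X → ℝ) : ℝ := ∑ x, ϖ x * |ψ x|

/-- The logarithmic mean of two nonnegative numbers. -/
def logMean (u v : ℝ) : ℝ :=
  if u = 0 ∨ v = 0 then 0
  else if u = v then v
  else (u - v) / (Real.log u - Real.log v)

/-- The mobility `μ̂ (x, y) = θ (μ x, μ y)`, with `θ` the logarithmic mean. -/
def mobility {X : Type*} (μ : X → ℝ) (x y : X) : ℝ := logMean (μ x) (μ y)

/-- The discrete gradient. -/
def grad {X : Type*} (ψ : X → ℝ) (x y : X) : ℝ := ψ y - ψ x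

/-- `(μ, ψ, h)` is an admissible triple on the time interval `[0, 1]` from `μ₀` to `μ₁`.
Only the values at times in `[0, 1]` matter. -/
structure IsAdmissible {X : Type*} [Fintype X] (K : Matrix X X ℝ) (p : X → ℝ) (μ₀ μ₁ : X → ℝ)
    (μ ψ : ℝ → X → ℝ) (h : ℝ → ℝ) : Prop where
  mem_densities : ∀ t ∈ Icc (0 : ℝ) 1, μ t ∈ densities X
  absolutelyContinuous : AbsolutelyContinuousOnInterval μ 0 1
  measurable_potential : Measurable ((Icc (0 : ℝ) 1).domRestrict ψ)
  measurable_source : Measurable ((Icc (0 : ℝ) 1).domRestrict h)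
  continuity_equation : ∀ᵐ t ∂(volume.restrict (Icc (0 : ℝ) 1)), ∀ x, ∃ d : ℝ,
    HasDerivAt (fun s => μ s x) d t ∧
      d + ∑ y, grad (ψ t) x y * mobility (μ t) x y * K x y = h t * p x
  start : μ 0 = μ₀
  finish : μ 1 = μ₁

/-- The squared norm `‖∇ψ‖²_μ` of the gradient of `ψ` at `μ`. -/
def gradNormSq {X : Type*} [Fintype X] (K : Matrix X X ℝ) (ϖ : X → ℝ) (μ ψ : X → ℝ) : ℝ :=
  1 / 2 * ∑ x, ∑ y, grad ψ x y ^ 2 * mobility μ x y * K x y * ϖ x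

/-- The quadratic action `a² ∫₀¹ h² dt + b² ∫₀¹ ‖∇ψ‖²_μ dt`, with values in `[0, ∞]`. -/
def action {X : Type*} [Fintype X] (K : Matrix X X ℝ) (ϖ : X → ℝ) (a b : ℝ)
    (μ ψ : ℝ → X → ℝ) (h : ℝ → ℝ) : ℝ≥0∞ :=
  ENNReal.ofReal (a ^ 2) * (∫⁻ t in Icc (0 : ℝ) 1, ENNReal.ofReal (h t ^ 2)) +
    ENNReal.ofReal (b ^ 2) *
      ∫⁻ t in Icc (0 : ℝ) 1, ENNReal.ofReal (gradNormSq K ϖ (μ t) (ψ t))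

/-- The Benamou--Brenier-type distance: the square root of the infimum of the action over all
admissible triples, a priori in `[0, ∞]`. -/
def dist {X : Type*} [Fintype X] (K : Matrix X X ℝ) (ϖ p : X → ℝ) (a b : ℝ) (μ₀ μ₁ : X → ℝ) :
    ℝ≥0∞ :=
  (⨅ (μ : ℝ → X → ℝ) (ψ : ℝ → X → ℝ) (h : ℝ → ℝ) (_ : IsAdmissible K p μ₀ μ₁ μ ψ h),
    action K ϖ a b μ ψ h) ^ (1 / 2 : ℝ)

end MarkovTransport

end

/-!
The proof is the direct method of the calculus of variations, applied to the velocity `f` of the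
curve alone.

The continuity equation, summed against `ϖ`, forces the source to be `h = ∑ ϖ f` (`sourceRate`).
Given the curve, the potential solves the weighted Poisson equation
`lap (edgeWeight K ϖ μ) ψ = ϖ (h p - f)`; all solutions have the same energy, with the dual form
`⨆ φ, 2 ⟨φ, ϖ (h p - f)⟩ - energy φ` (`kineticCost`). The action of a triple thereby becomes
`∫ lagrangian (μ_t, f_t)`, see `IsAdmissible.exists_velocity`. As a supremum of continuous functions
the Lagrangian is lower semicontinuous in `(μ, f)`, up to the boundary of the cone of densities; as
the logarithmic mean is concave (`logMean_add_le`) it is jointly convex, see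
`lagrangian_midpoint`. Conversely a velocity of finite cost yields an admissible triple
(`IsVelocity.exists_admissible`): at almost every time the finite dual supremum makes the
right-hand side orthogonal to the kernel of the Laplacian, hence the equation solvable, and a
solution measurable in time is obtained as the limit of Tikhonov regularisations
(`exists_measurable_potential`).

Curves of bounded cost have bounded mass, so the Lagrangian controls the square of the velocity and
the sublevel sets of the cost are bounded convex subsets of `L²([0, 1]; ℝ^X)`
(`exists_lintegral_sq_le`). Elements of almost minimal norm of the sets of `1 / n`-minimisers form a
Cauchy sequence by the parallelogram identity (`exists_cauchySeq_of_midpoint`), and Fatou's lemma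
shows that its strong limit is a minimiser (`isVelocity_and_cost_le_of_tendsto`).

Finiteness follows from an explicit curve: an additional source term `t (1 - t) p` keeps the density
positive in the interior of the time interval, while the given densities are interpolated with a
velocity that vanishes at both ends (`exists_velocity_cost_ne_top`).
-/

noncomputable section

namespace MarkovTransport

open Filter Topology

/-! ### The logarithmic mean -/

lemma logMean_eq_integral {u v : ℝ} (hu : 0 ≤ u) (hv : 0 ≤ v) :
    logMean u v = ∫ ξ in (0 : ℝ)..1, u ^ ξ * v ^ (1 - ξ) := by
  have key : ∀ F : ℝ → ℝ, (∀ ξ ∈ Ioo (0 : ℝ) 1, u ^ ξ * v ^ (1 - ξ) = F ξ) →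
      ∫ ξ in (0 : ℝ)..1, u ^ ξ * v ^ (1 - ξ) = ∫ ξ in (0 : ℝ)..1, F ξ := by
    intro F hF
    rw [intervalIntegral.integral_of_le zero_le_one, intervalIntegral.integral_of_le zero_le_one,
      integral_Ioc_eq_integral_Ioo, integral_Ioc_eq_integral_Ioo]
    exact setIntegral_congr_fun measurableSet_Ioo hF
  unfold logMean
  split_ifs with h0 huv
  · rw [key (fun _ => 0)]
    · simp
    · rintro ξ ⟨h1, h2⟩
      rcases h0 with h0 | h0
      · simp [h0, Real.zero_rpow h1.ne']
      · simp [h0, Real.zero_rpow (sub_pos.2 h2).ne']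
  · subst huv
    rw [key (fun _ => u)]
    · simp
    · rintro ξ -
      push Not at h0
      rw [← Real.rpow_add (lt_of_le_of_ne hu (Ne.symm h0.1))]
      simp
  · push Not at h0
    have hu' : 0 < u := lt_of_le_of_ne hu (Ne.symm h0.1)
    have hv' : 0 < v := lt_of_le_of_ne hv (Ne.symm h0.2)
    have hl : Real.log u - Real.log v ≠ 0 := by
      rw [sub_ne_zero]
      exact fun h => huv (Real.log_injOn_pos hu' hv' h)
    rw [key (fun ξ => Real.exp (Real.log v + (Real.log u - Real.log v) * ξ))]
    · have hd : ∀ ξ ∈ uIcc (0 : ℝ) 1, HasDerivAt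
          (fun ξ => Real.exp (Real.log v + (Real.log u - Real.log v) * ξ) /
            (Real.log u - Real.log v))
          (Real.exp (Real.log v + (Real.log u - Real.log v) * ξ)) ξ := by
        intro ξ _
        have := ((((hasDerivAt_id ξ).const_mul (Real.log u - Real.log v)).const_add
          (Real.log v)).exp).div_const (Real.log u - Real.log v)
        simpa [hl] using this
      rw [intervalIntegral.integral_eq_sub_of_hasDerivAt hd
        (Continuous.intervalIntegrable (by fun_prop) _ _)]
      simp [Real.exp_log hu', Real.exp_log hv', sub_div]
    · rintro ξ -
      rw [Real.rpow_def_of_pos hu', Real.rpow_def_of_pos hv', ← Real.exp_add]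
      ring_nf

lemma continuousOn_geomMean {u v : ℝ} :
    ContinuousOn (fun ξ : ℝ => u ^ ξ * v ^ (1 - ξ)) (Ioo 0 1) := by
  intro ξ hξ
  have h1 : ContinuousAt (fun ξ : ℝ => u ^ ξ) ξ := Real.continuousAt_const_rpow' hξ.1.ne'
  have h2 : ContinuousAt (fun ξ : ℝ => v ^ (1 - ξ)) ξ :=
    ContinuousAt.comp (f := fun ξ : ℝ => 1 - ξ) (g := fun η => v ^ η)
      (Real.continuousAt_const_rpow' (sub_pos.2 hξ.2).ne') (by fun_prop)
  exact (h1.mul h2).continuousWithinAt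

lemma geomMean_le_add {u v ξ : ℝ} (hu : 0 ≤ u) (hv : 0 ≤ v) (hξ : ξ ∈ Icc (0 : ℝ) 1) :
    u ^ ξ * v ^ (1 - ξ) ≤ u + v := by
  have := Real.geom_mean_le_arith_mean2_weighted hξ.1 (sub_nonneg.2 hξ.2) hu hv (by ring)
  nlinarith [hξ.1, hξ.2]

lemma aestronglyMeasurable_geomMean (u v : ℝ) :
    AEStronglyMeasurable (fun ξ : ℝ => u ^ ξ * v ^ (1 - ξ)) (volume.restrict (Ioc 0 1)) := by
  rw [← restrict_Ioo_eq_restrict_Ioc]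
  exact continuousOn_geomMean.aestronglyMeasurable measurableSet_Ioo

lemma intervalIntegrable_geomMean {u v : ℝ} (hu : 0 ≤ u) (hv : 0 ≤ v) :
    IntervalIntegrable (fun ξ : ℝ => u ^ ξ * v ^ (1 - ξ)) volume 0 1 := by
  rw [intervalIntegrable_iff_integrableOn_Ioc_of_le zero_le_one]
  refine Integrable.mono' (g := fun _ => u + v) (by simp)
    (aestronglyMeasurable_geomMean u v) ?_
  filter_upwards [ae_restrict_mem measurableSet_Ioc] with ξ hξ
  rw [Real.norm_of_nonneg (by positivity)]
  exact geomMean_le_add hu hv ⟨hξ.1.le, hξ.2⟩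

lemma logMean_nonneg {u v : ℝ} (hu : 0 ≤ u) (hv : 0 ≤ v) : 0 ≤ logMean u v := by
  rw [logMean_eq_integral hu hv]
  exact intervalIntegral.integral_nonneg zero_le_one fun ξ _ => by positivity

lemma logMean_comm (u v : ℝ) : logMean u v = logMean v u := by
  unfold logMean
  by_cases h : u = 0 ∨ v = 0
  · rw [if_pos h, if_pos h.symm]
  · have h' : ¬(v = 0 ∨ u = 0) := fun h' => h h'.symm
    simp only [if_neg h, if_neg h']
    by_cases h2 : u = v
    · simp only [h2]
    · rw [if_neg h2, if_neg (Ne.symm h2), ← neg_sub v u, ← neg_sub (Real.log v), neg_div_neg_eq]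

lemma logMean_le_add {u v : ℝ} (hu : 0 ≤ u) (hv : 0 ≤ v) : logMean u v ≤ u + v := by
  rw [logMean_eq_integral hu hv]
  calc _ ≤ ∫ _ in (0 : ℝ)..1, (u + v) :=
        intervalIntegral.integral_mono_on zero_le_one (intervalIntegrable_geomMean hu hv)
          (by simp) fun ξ hξ => geomMean_le_add hu hv hξ
    _ = u + v := by simp

lemma le_logMean {m u v : ℝ} (hm : 0 < m) (hu : m ≤ u) (hv : m ≤ v) : m ≤ logMean u v := by
  rw [logMean_eq_integral (hm.le.trans hu) (hm.le.trans hv)]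
  calc m = ∫ _ in (0 : ℝ)..1, m := by simp
    _ ≤ _ := intervalIntegral.integral_mono_on zero_le_one (by simp)
        (intervalIntegrable_geomMean (hm.le.trans hu) (hm.le.trans hv)) fun ξ hξ => by
          calc m = m ^ ξ * m ^ (1 - ξ) := by rw [← Real.rpow_add hm]; simp
            _ ≤ _ := mul_le_mul (Real.rpow_le_rpow hm.le hu hξ.1)
              (Real.rpow_le_rpow hm.le hv (sub_nonneg.2 hξ.2)) (by positivity)
              (Real.rpow_nonneg (hm.le.trans hu) _)

lemma geomMean_add_le {u v u' v' ξ : ℝ} (hu : 0 ≤ u) (hv : 0 ≤ v) (hu' : 0 ≤ u') (hv' : 0 ≤ v')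
    (hξ : ξ ∈ Ioo (0 : ℝ) 1) :
    u ^ ξ * v ^ (1 - ξ) + u' ^ ξ * v' ^ (1 - ξ) ≤ (u + u') ^ ξ * (v + v') ^ (1 - ξ) := by
  have h1 : (1 - ξ) ≠ 0 := (sub_pos.2 hξ.2).ne'
  rcases (add_nonneg hu hu').eq_or_lt with h | hU
  · have e1 : u = 0 := by linarith
    have e2 : u' = 0 := by linarith
    simp [e1, e2, Real.zero_rpow hξ.1.ne']
  rcases (add_nonneg hv hv').eq_or_lt with h | hV
  · have e1 : v = 0 := by linarith
    have e2 : v' = 0 := by linarith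
    simp [e1, e2, Real.zero_rpow h1]
  have a1 := Real.geom_mean_le_arith_mean2_weighted hξ.1.le (sub_nonneg.2 hξ.2.le)
    (div_nonneg hu hU.le) (div_nonneg hv hV.le) (by ring)
  have a2 := Real.geom_mean_le_arith_mean2_weighted hξ.1.le (sub_nonneg.2 hξ.2.le)
    (div_nonneg hu' hU.le) (div_nonneg hv' hV.le) (by ring)
  rw [Real.div_rpow hu hU.le, Real.div_rpow hv hV.le] at a1
  rw [Real.div_rpow hu' hU.le, Real.div_rpow hv' hV.le] at a2
  have hs : ξ * (u / (u + u')) + (1 - ξ) * (v / (v + v')) +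
      (ξ * (u' / (u + u')) + (1 - ξ) * (v' / (v + v'))) = 1 := by
    field_simp; ring
  have hP : 0 < (u + u') ^ ξ * (v + v') ^ (1 - ξ) := by positivity
  have := mul_le_mul_of_nonneg_right ((add_le_add a1 a2).trans_eq hs) hP.le
  rw [one_mul] at this
  refine le_trans (le_of_eq ?_) this
  have := Real.rpow_pos_of_pos hU ξ
  have := Real.rpow_pos_of_pos hV (1 - ξ)
  field_simp

/-- Superadditivity, which for this 1-homogeneous function amounts to concavity. It is inherited
from the weighted geometric means `u ^ ξ * v ^ (1 - ξ)`. -/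
lemma logMean_add_le {u v u' v' : ℝ} (hu : 0 ≤ u) (hv : 0 ≤ v) (hu' : 0 ≤ u') (hv' : 0 ≤ v') :
    logMean u v + logMean u' v' ≤ logMean (u + u') (v + v') := by
  rw [logMean_eq_integral hu hv, logMean_eq_integral hu' hv',
    logMean_eq_integral (add_nonneg hu hu') (add_nonneg hv hv'),
    ← intervalIntegral.integral_add (intervalIntegrable_geomMean hu hv)
      (intervalIntegrable_geomMean hu' hv')]
  refine intervalIntegral.integral_mono_on_of_le_Ioo zero_le_one
    ((intervalIntegrable_geomMean hu hv).add (intervalIntegrable_geomMean hu' hv'))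
    (intervalIntegrable_geomMean (add_nonneg hu hu') (add_nonneg hv hv'))
    fun ξ hξ => geomMean_add_le hu hv hu' hv' hξ

lemma logMean_half {u v : ℝ} : logMean (u / 2) (v / 2) = logMean u v / 2 := by
  unfold logMean
  by_cases h0 : u = 0 ∨ v = 0
  · rw [if_pos h0, if_pos (by rcases h0 with h | h <;> simp [h])]; simp
  · rw [if_neg h0, if_neg (by simpa using h0)]
    push Not at h0
    by_cases h : u = v
    · simp [h]
    · rw [if_neg h, if_neg (by simpa using h), Real.log_div h0.1 two_ne_zero,
        Real.log_div h0.2 two_ne_zero]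
      ring

lemma logMean_midpoint {u v u' v' : ℝ} (hu : 0 ≤ u) (hv : 0 ≤ v) (hu' : 0 ≤ u') (hv' : 0 ≤ v') :
    (logMean u v + logMean u' v') / 2 ≤ logMean ((u + u') / 2) ((v + v') / 2) := by
  rw [logMean_half]
  linarith [logMean_add_le hu hv hu' hv']

/-- Extended from the quadrant to the plane by positive parts, the logarithmic mean is continuous,
including on the boundary of the quadrant. -/
lemma continuous_logMean_max :
    Continuous fun q : ℝ × ℝ => logMean (max q.1 0) (max q.2 0) := by
  have : (fun q : ℝ × ℝ => logMean (max q.1 0) (max q.2 0)) =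
      fun q => ∫ ξ in Ioc (0 : ℝ) 1, (max q.1 0) ^ ξ * (max q.2 0) ^ (1 - ξ) := by
    funext q
    rw [logMean_eq_integral (le_max_right _ _) (le_max_right _ _),
      intervalIntegral.integral_of_le zero_le_one]
  rw [this, continuous_iff_continuousAt]
  intro q
  refine continuousAt_of_dominated
    (bound := fun _ => (max q.1 0 + max q.2 0) + 1) ?_ ?_ (by simp) ?_
  · exact Eventually.of_forall fun q => aestronglyMeasurable_geomMean _ _
  · have hc : ContinuousAt (fun q : ℝ × ℝ => max q.1 0 + max q.2 0) q :=
      Continuous.continuousAt (by fun_prop)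
    filter_upwards [hc.eventually_lt_const (lt_add_one _)] with r hr
    filter_upwards [ae_restrict_mem measurableSet_Ioc] with ξ hξ
    rw [Real.norm_of_nonneg (by positivity)]
    exact (geomMean_le_add (le_max_right _ _) (le_max_right _ _) ⟨hξ.1.le, hξ.2⟩).trans hr.le
  · rw [← restrict_Ioo_eq_restrict_Ioc]
    filter_upwards [ae_restrict_mem measurableSet_Ioo] with ξ hξ
    have h1 : Continuous fun q : ℝ × ℝ => (max q.1 0) ^ ξ :=
      (Real.continuous_rpow_const hξ.1.le).comp (by fun_prop)
    have h2 : Continuous fun q : ℝ × ℝ => (max q.2 0) ^ (1 - ξ) :=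
      (Real.continuous_rpow_const (sub_pos.2 hξ.2).le).comp (by fun_prop)
    exact (h1.mul h2).continuousAt

/-! ### Singular symmetric linear systems -/

section Tikhonov

open Matrix

variable {X : Type*} [Fintype X]

lemma exists_mulVec_eq_of_orthogonal_ker {S : Matrix X X ℝ} (hS : S.IsHermitian) {g : X → ℝ}
    (hg : ∀ φ : X → ℝ, S *ᵥ φ = 0 → φ ⬝ᵥ g = 0) : ∃ ψ : X → ℝ, S *ᵥ ψ = g := by
  classical
  have hsym := Matrix.isSymmetric_toEuclideanLin_iff.2 hS
  have hmem : WithLp.toLp 2 g ∈ LinearMap.range (Matrix.toEuclideanLin S) := by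
    rw [← Submodule.orthogonal_orthogonal (LinearMap.range (Matrix.toEuclideanLin S)),
      hsym.orthogonal_range, Submodule.mem_orthogonal]
    intro u hu
    have h0 : S *ᵥ u.ofLp = 0 := by
      have := congrArg WithLp.ofLp (LinearMap.mem_ker.1 hu)
      simpa using this
    have := hg _ h0
    rw [EuclideanSpace.inner_eq_star_dotProduct]
    simpa [dotProduct_comm] using this
  obtain ⟨ψ, hψ⟩ := hmem
  refine ⟨ψ.ofLp, ?_⟩
  have := congrArg WithLp.ofLp hψ
  simpa using this

lemma sq_dotProduct_le (v w : X → ℝ) : (v ⬝ᵥ w) ^ 2 ≤ (v ⬝ᵥ v) * (w ⬝ᵥ w) := by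
  have := Finset.sum_mul_sq_le_sq_mul_sq Finset.univ v w
  simpa [dotProduct, sq] using this

variable [DecidableEq X]

/-- The Tikhonov-regularised solution `(S + ε)⁻¹ g`, with `ε = 1 / (n + 1)`, of `S ψ = g`. -/
def tikhonov (S : Matrix X X ℝ) (g : X → ℝ) (n : ℕ) : X → ℝ :=
  (S + (1 / ((n : ℝ) + 1)) • (1 : Matrix X X ℝ))⁻¹ *ᵥ g

lemma isUnit_add_smul_one {S : Matrix X X ℝ} (hS : S.PosSemidef) {ε : ℝ} (hε : 0 < ε) :
    IsUnit (S + ε • (1 : Matrix X X ℝ)) :=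
  (Matrix.PosDef.posSemidef_add hS (Matrix.PosDef.one.smul hε)).isUnit

/-- The regularised solutions converge whenever the system is solvable; this selects a solution
depending measurably on the data. -/
lemma exists_tendsto_tikhonov {S : Matrix X X ℝ} (hS : S.PosSemidef) {ψ : X → ℝ} :
    ∃ ψ' : X → ℝ, S *ᵥ ψ' = S *ᵥ ψ ∧ Tendsto (tikhonov S (S *ᵥ ψ)) atTop (𝓝 ψ') := by
  -- `S` and `S ^ 2` have the same range, so the right-hand side is `S (S χ)`.
  obtain ⟨χ, hχ⟩ : ∃ χ, S *ᵥ (S *ᵥ χ) = S *ᵥ ψ := by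
    have h2 : (S * S).IsHermitian := by
      rw [Matrix.IsHermitian, conjTranspose_mul, hS.1.eq]
    obtain ⟨χ, hχ⟩ := exists_mulVec_eq_of_orthogonal_ker h2 (g := S *ᵥ ψ) (by
      intro φ hφ
      have hz : S *ᵥ φ = 0 := by
        have : (S *ᵥ φ) ⬝ᵥ (S *ᵥ φ) = 0 := by
          rw [← mulVec_mulVec] at hφ
          have e : (S *ᵥ φ) ⬝ᵥ (S *ᵥ φ) = φ ⬝ᵥ (S *ᵥ (S *ᵥ φ)) := by
            rw [dotProduct_mulVec φ, ← mulVec_transpose]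
            congr 2
            simpa using hS.1.eq.symm
          rw [e, hφ, dotProduct_zero]
        exact dotProduct_self_eq_zero.1 this
      rw [dotProduct_mulVec, ← mulVec_transpose]
      have : Sᵀ = S := by simpa using hS.1.eq
      rw [this, hz, zero_dotProduct])
    exact ⟨χ, by rw [mulVec_mulVec, hχ]⟩
  refine ⟨S *ᵥ χ, hχ, ?_⟩
  have hε0 : Tendsto (fun n : ℕ => 1 / ((n : ℝ) + 1)) atTop (𝓝 0) :=
    tendsto_one_div_add_atTop_nhds_zero_nat
  -- With `v = ε (S + ε)⁻¹ χ` the error is `- ε (χ - v)`, and `|v| ≤ |χ|`.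
  have hv : ∀ ε : ℝ, 0 < ε → ∃ v : X → ℝ, v ⬝ᵥ v ≤ χ ⬝ᵥ χ ∧
      (S + ε • (1 : Matrix X X ℝ))⁻¹ *ᵥ (S *ᵥ ψ) = S *ᵥ χ - ε • (χ - v) := by
    intro ε hε
    have hu := isUnit_add_smul_one hS hε
    have hdet := (Matrix.isUnit_iff_isUnit_det _).1 hu
    set M := S + ε • (1 : Matrix X X ℝ) with hM
    have hMv : ∀ z, M *ᵥ z = S *ᵥ z + ε • z := by
      intro z; rw [hM, add_mulVec, smul_mulVec, one_mulVec]
    set v := M⁻¹ *ᵥ (ε • χ) with hvdef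
    have hvM : S *ᵥ v + ε • v = ε • χ := by
      rw [← hMv, hvdef, mulVec_mulVec, Matrix.mul_nonsing_inv _ hdet, one_mulVec]
    refine ⟨v, ?_, ?_⟩
    · have hpos : 0 ≤ v ⬝ᵥ (S *ᵥ v) := by simpa using hS.dotProduct_mulVec_nonneg v
      have h1 : v ⬝ᵥ (S *ᵥ v) + ε * (v ⬝ᵥ v) = ε * (v ⬝ᵥ χ) := by
        rw [← smul_eq_mul, ← smul_eq_mul, ← dotProduct_smul, ← dotProduct_smul, ← dotProduct_add,
          hvM]
      have h2 : v ⬝ᵥ v ≤ v ⬝ᵥ χ := by nlinarith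
      have h3 := sq_dotProduct_le v χ
      have h4 : 0 ≤ v ⬝ᵥ v := by
        simpa [dotProduct] using Finset.sum_nonneg fun i _ => mul_self_nonneg (v i)
      rcases h4.eq_or_lt with h5 | h5
      · rw [← h5]; simpa [dotProduct] using Finset.sum_nonneg fun i _ => mul_self_nonneg (χ i)
      · nlinarith
    · have : M *ᵥ (S *ᵥ χ - ε • (χ - v)) = S *ᵥ ψ := by
        have hSv : S *ᵥ v = ε • χ - ε • v := eq_sub_of_add_eq hvM
        rw [hMv, mulVec_sub, mulVec_smul, mulVec_sub, hχ, hSv]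
        ext i
        simp only [Pi.add_apply, Pi.sub_apply, Pi.smul_apply, smul_eq_mul]
        ring
      rw [← this, mulVec_mulVec, Matrix.nonsing_inv_mul _ hdet, one_mulVec]
  rw [tendsto_pi_nhds]
  intro x
  set C := Real.sqrt (χ ⬝ᵥ χ)
  have hcoord : ∀ v : X → ℝ, v ⬝ᵥ v ≤ χ ⬝ᵥ χ → |v x| ≤ C := by
    intro v hv
    apply Real.abs_le_sqrt
    refine le_trans ?_ hv
    rw [sq]
    exact Finset.single_le_sum (f := fun i => v i * v i) (fun i _ => mul_self_nonneg _)
      (Finset.mem_univ x)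
  rw [tendsto_iff_norm_sub_tendsto_zero]
  refine squeeze_zero (g := fun n : ℕ => 1 / ((n : ℝ) + 1) * (C + C)) (fun _ => norm_nonneg _)
    ?_ (by simpa using hε0.mul_const (C + C))
  intro n
  have hε : 0 < 1 / ((n : ℝ) + 1) := by positivity
  obtain ⟨v, hv1, hv2⟩ := hv _ hε
  have : tikhonov S (S *ᵥ ψ) n x - (S *ᵥ χ) x = -(1 / ((n : ℝ) + 1) * (χ x - v x)) := by
    rw [tikhonov, hv2]; simp
  rw [this, norm_neg, norm_mul, Real.norm_of_nonneg hε.le]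
  refine mul_le_mul_of_nonneg_left ?_ hε.le
  exact (norm_sub_le _ _).trans (add_le_add (hcoord χ le_rfl) (hcoord v hv1))

lemma measurable_tikhonov {Ω : Type*} [MeasurableSpace Ω] {S : Ω → Matrix X X ℝ}
    {g : Ω → X → ℝ} (hS : ∀ x y, Measurable fun t => S t x y) (hg : Measurable g) (n : ℕ) :
    Measurable fun t => tikhonov (S t) (g t) n := by
  have hdet : ∀ A : Ω → Matrix X X ℝ, (∀ x y, Measurable fun t => A t x y) →
      Measurable fun t => (A t).det := by
    intro A hA
    simp only [Matrix.det_apply]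
    exact Finset.measurable_sum _ fun σ _ =>
      (Finset.measurable_prod _ fun i _ => hA _ _).const_smul _
  set A : Ω → Matrix X X ℝ := fun t => S t + (1 / ((n : ℝ) + 1)) • (1 : Matrix X X ℝ) with hA
  have hAm : ∀ x y, Measurable fun t => A t x y := fun x y => (hS x y).add_const _
  have hgx : ∀ y, Measurable fun t => g t y := fun y => (measurable_pi_apply y).comp hg
  have hinv : ∀ x y, Measurable fun t => (A t)⁻¹ x y := by
    intro x y
    simp only [Matrix.inv_def, Ring.inverse_eq_inv', Matrix.smul_apply, smul_eq_mul,
      Matrix.adjugate_apply]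
    refine (hdet A hAm).inv.mul (hdet _ ?_)
    intro i j
    by_cases h : i = y
    · simp [h]
    · simpa [Matrix.updateRow_ne h] using hAm i j
  refine measurable_pi_lambda _ fun x => ?_
  simp only [tikhonov, mulVec, dotProduct]
  exact Finset.measurable_sum _ fun y _ => (hinv x y).mul (hgx y)

end Tikhonov

/-! ### Weighted graph Laplacians and the kinetic cost -/

section Laplacian

variable {X : Type*} [Fintype X]

/-- The Dirichlet energy of `φ` on the graph with edge weights `w`. -/
def energy (w : X → X → ℝ) (φ : X → ℝ) : ℝ := 1 / 2 * ∑ x, ∑ y, grad φ x y ^ 2 * w x y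

/-- The graph Laplacian (with its nonpositive sign) for the edge weights `w`. -/
def lap (w : X → X → ℝ) (ψ : X → ℝ) (x : X) : ℝ := ∑ y, grad ψ x y * w x y

lemma energy_nonneg {w : X → X → ℝ} (hw : ∀ x y, 0 ≤ w x y) (φ : X → ℝ) : 0 ≤ energy w φ :=
  mul_nonneg (by norm_num) (Finset.sum_nonneg fun x _ => Finset.sum_nonneg fun y _ =>
    mul_nonneg (sq_nonneg _) (hw x y))

/-- Discrete integration by parts. -/
lemma sum_mul_lap {w : X → X → ℝ} (hw : ∀ x y, w x y = w y x) (φ ψ : X → ℝ) :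
    ∑ x, φ x * lap w ψ x = -(1 / 2 * ∑ x, ∑ y, grad φ x y * grad ψ x y * w x y) := by
  have h1 : ∑ x, φ x * lap w ψ x = ∑ x, ∑ y, φ x * grad ψ x y * w x y := by
    simp only [lap, Finset.mul_sum, mul_assoc]
  have h2 : ∑ x, φ x * lap w ψ x = ∑ x, ∑ y, -(φ y * grad ψ x y * w x y) := by
    rw [h1, Finset.sum_comm]
    refine Finset.sum_congr rfl fun x _ => Finset.sum_congr rfl fun y _ => ?_
    rw [hw y x]; simp only [grad]; ring
  have h3 : ∑ x, ∑ y, grad φ x y * grad ψ x y * w x y =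
      ∑ x, ∑ y, -(-(φ y * grad ψ x y * w x y)) - ∑ x, ∑ y, φ x * grad ψ x y * w x y := by
    rw [← Finset.sum_sub_distrib]
    refine Finset.sum_congr rfl fun x _ => ?_
    rw [← Finset.sum_sub_distrib]
    refine Finset.sum_congr rfl fun y _ => ?_
    simp only [grad]; ring
  rw [h3, ← h1]
  simp only [Finset.sum_neg_distrib] at h2 ⊢
  linarith

lemma sum_mul_lap_self {w : X → X → ℝ} (hw : ∀ x y, w x y = w y x) (ψ : X → ℝ) :
    ∑ x, ψ x * lap w ψ x = -energy w ψ := by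
  rw [sum_mul_lap hw, energy]
  simp only [sq]

lemma energy_add_smul {w : X → X → ℝ} (hw : ∀ x y, w x y = w y x) (φ ψ : X → ℝ) (s : ℝ) :
    energy w (φ + s • ψ) = energy w φ - 2 * s * ∑ x, φ x * lap w ψ x + s ^ 2 * energy w ψ := by
  rw [sum_mul_lap hw, energy, energy, energy]
  have : ∑ x, ∑ y, grad (φ + s • ψ) x y ^ 2 * w x y = (∑ x, ∑ y, grad φ x y ^ 2 * w x y) +
      2 * s * (∑ x, ∑ y, grad φ x y * grad ψ x y * w x y) +
      s ^ 2 * ∑ x, ∑ y, grad ψ x y ^ 2 * w x y := by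
    simp only [Finset.mul_sum, ← Finset.sum_add_distrib]
    refine Finset.sum_congr rfl fun x _ => Finset.sum_congr rfl fun y _ => ?_
    simp only [grad, Pi.add_apply, Pi.smul_apply, smul_eq_mul]; ring
  rw [this]; ring

lemma energy_smul (w : X → X → ℝ) (ψ : X → ℝ) (s : ℝ) :
    energy w (s • ψ) = s ^ 2 * energy w ψ := by
  simp only [energy, grad, Pi.smul_apply, smul_eq_mul, Finset.mul_sum]
  refine Finset.sum_congr rfl fun x _ => Finset.sum_congr rfl fun y _ => ?_
  ring

lemma lap_smul (w : X → X → ℝ) (ψ : X → ℝ) (s : ℝ) : lap w (s • ψ) = s • lap w ψ := by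
  funext x
  simp only [lap, grad, Pi.smul_apply, smul_eq_mul, Finset.mul_sum]
  exact Finset.sum_congr rfl fun y _ => by ring

open Matrix in
/-- The matrix of `-lap w`. -/
def lapMatrix [DecidableEq X] (w : X → X → ℝ) : Matrix X X ℝ :=
  Matrix.of fun x y => (if x = y then ∑ z, w x z else 0) - w x y

open Matrix in
lemma lapMatrix_mulVec [DecidableEq X] (w : X → X → ℝ) (ψ : X → ℝ) :
    lapMatrix w *ᵥ ψ = -lap w ψ := by
  funext x
  simp only [lapMatrix, mulVec, dotProduct, of_apply, sub_mul, Finset.sum_sub_distrib, ite_mul,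
    zero_mul, Finset.sum_ite_eq, Finset.mem_univ, if_true, Pi.neg_apply, lap, grad,
    Finset.sum_mul]
  rw [neg_sub]
  congr 1 <;> exact Finset.sum_congr rfl fun y _ => mul_comm _ _

open Matrix in
lemma posSemidef_lapMatrix [DecidableEq X] {w : X → X → ℝ} (hw : ∀ x y, w x y = w y x)
    (hw0 : ∀ x y, 0 ≤ w x y) : (lapMatrix w).PosSemidef := by
  refine PosSemidef.of_dotProduct_mulVec_nonneg ?_ fun ψ => ?_
  · ext x y
    simp only [conjTranspose_apply, lapMatrix, of_apply, star_trivial, hw y x]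
    by_cases h : x = y
    · simp [h]
    · simp [h, Ne.symm h]
  · rw [lapMatrix_mulVec, dotProduct_neg, star_trivial]
    have := sum_mul_lap_self hw ψ
    simp only [dotProduct]
    linarith [energy_nonneg hw0 ψ]

open Matrix in
/-- The Laplacian is onto the functions orthogonal to its kernel, the latter being described by
vanishing energy. -/
lemma exists_lap_eq {w : X → X → ℝ} (hw : ∀ x y, w x y = w y x) (hw0 : ∀ x y, 0 ≤ w x y)
    {G : X → ℝ} (hG : ∀ φ, energy w φ = 0 → ∑ x, φ x * G x = 0) : ∃ ψ, lap w ψ = G := by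
  classical
  obtain ⟨ψ, hψ⟩ := exists_mulVec_eq_of_orthogonal_ker (posSemidef_lapMatrix hw hw0).1 (g := -G)
    (by
      intro φ hφ
      rw [lapMatrix_mulVec, neg_eq_zero] at hφ
      have := sum_mul_lap_self hw φ
      rw [dotProduct_neg, neg_eq_zero]
      refine hG φ ?_
      simp only [hφ, Pi.zero_apply, mul_zero, Finset.sum_const_zero] at this
      linarith)
  rw [lapMatrix_mulVec, neg_inj] at hψ
  exact ⟨ψ, hψ⟩

/-- For symmetric nonnegative weights, the least energy `energy w ψ` of a potential `ψ` with
`lap w ψ = G`, in its dual formulation; it is `∞` if there is no such potential. -/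
def kineticCost (w : X → X → ℝ) (G : X → ℝ) : ℝ≥0∞ :=
  ⨆ φ : X → ℝ, ENNReal.ofReal (2 * ∑ x, φ x * G x - energy w φ)

lemma le_kineticCost (w : X → X → ℝ) (G φ : X → ℝ) :
    ENNReal.ofReal (2 * ∑ x, φ x * G x - energy w φ) ≤ kineticCost w G :=
  le_iSup (fun φ : X → ℝ => ENNReal.ofReal (2 * ∑ x, φ x * G x - energy w φ)) φ

lemma kineticCost_lap {w : X → X → ℝ} (hw : ∀ x y, w x y = w y x) (hw0 : ∀ x y, 0 ≤ w x y)
    (ψ : X → ℝ) : kineticCost w (lap w ψ) = ENNReal.ofReal (energy w ψ) := by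
  refine le_antisymm (iSup_le fun φ => ENNReal.ofReal_le_ofReal ?_) ?_
  · have := energy_add_smul hw φ ψ 1
    have h := energy_nonneg hw0 (φ + (1 : ℝ) • ψ)
    linarith
  · refine le_trans (ENNReal.ofReal_le_ofReal ?_) (le_kineticCost w _ (-ψ))
    have h1 := sum_mul_lap_self hw ψ
    have h2 := energy_smul w ψ (-1)
    simp only [neg_smul, one_smul] at h2
    simp only [Pi.neg_apply, neg_mul, Finset.sum_neg_distrib, h1, h2]
    linarith

lemma exists_lap_eq_of_kineticCost_ne_top {w : X → X → ℝ} (hw : ∀ x y, w x y = w y x)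
    (hw0 : ∀ x y, 0 ≤ w x y) {G : X → ℝ} (hG : kineticCost w G ≠ ∞) : ∃ ψ, lap w ψ = G := by
  refine exists_lap_eq hw hw0 fun φ hφ => ?_
  by_contra hne
  set c := ∑ x, φ x * G x with hc
  -- Along multiples of a zero-energy `φ` pairing nontrivially with `G` the cost is unbounded.
  set R := (kineticCost w G).toReal
  have := le_kineticCost w G (((R + 1) / c) • φ)
  have h2 : 2 * ∑ x, (((R + 1) / c) • φ) x * G x - energy w (((R + 1) / c) • φ) = 2 * (R + 1) := by
    rw [energy_smul, hφ]
    simp only [Pi.smul_apply, smul_eq_mul, mul_assoc, ← Finset.mul_sum]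
    rw [← hc]; field_simp; ring
  simp only [h2] at this
  have h3 := (ENNReal.ofReal_le_iff_le_toReal hG).1 this
  have : 0 ≤ R := ENNReal.toReal_nonneg
  change 2 * (R + 1) ≤ R at h3
  linarith

/-- A potential can be chosen measurably in a parameter. -/
lemma exists_measurable_potential {Ω : Type*} [MeasurableSpace Ω] {w : Ω → X → X → ℝ}
    {G : Ω → X → ℝ} (hwm : ∀ x y, Measurable fun t => w t x y) (hG : Measurable G) :
    ∃ ψ : Ω → X → ℝ, Measurable ψ ∧ ∀ t, (∀ x y, w t x y = w t y x) → (∀ x y, 0 ≤ w t x y) →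
      kineticCost (w t) (G t) ≠ ∞ → lap (w t) (ψ t) = G t := by
  classical
  refine ⟨fun t => limUnder atTop (tikhonov (lapMatrix (w t)) (-G t)), ?_, ?_⟩
  · refine StronglyMeasurable.measurable (StronglyMeasurable.limUnder
      (f := fun n t => tikhonov (lapMatrix (w t)) (-G t) n) fun n => ?_)
    refine (measurable_tikhonov (fun x y => ?_) hG.neg n).stronglyMeasurable
    simp only [lapMatrix, Matrix.of_apply]
    refine Measurable.sub ?_ (hwm x y)
    split_ifs
    · exact Finset.measurable_sum _ fun z _ => hwm x z
    · exact measurable_const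
  · intro t hw hw0 hfin
    obtain ⟨ψ, hψ⟩ := exists_lap_eq_of_kineticCost_ne_top hw hw0 hfin
    obtain ⟨ψ', h1, h2⟩ := exists_tendsto_tikhonov (posSemidef_lapMatrix hw hw0) (ψ := ψ)
    rw [lapMatrix_mulVec _ ψ, hψ] at h1 h2
    rw [lapMatrix_mulVec, neg_inj] at h1
    simpa only [h2.limUnder_eq] using h1

end Laplacian

/-! ### The Lagrangian -/

section Lagrangian

variable {X : Type*} [Fintype X]

lemma energy_mono {w w' : X → X → ℝ} (h : ∀ x y, w x y ≤ w' x y) (φ : X → ℝ) :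
    energy w φ ≤ energy w' φ := by
  refine mul_le_mul_of_nonneg_left ?_ (by norm_num)
  exact Finset.sum_le_sum fun x _ => Finset.sum_le_sum fun y _ =>
    mul_le_mul_of_nonneg_left (h x y) (sq_nonneg _)

lemma kineticCost_anti {w w' : X → X → ℝ} (h : ∀ x y, w x y ≤ w' x y) (G : X → ℝ) :
    kineticCost w' G ≤ kineticCost w G :=
  iSup_mono fun φ => ENNReal.ofReal_le_ofReal (by linarith [energy_mono h φ])

lemma kineticCost_midpoint {w w₁ w₂ : X → X → ℝ} (h : ∀ x y, (w₁ x y + w₂ x y) / 2 ≤ w x y)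
    {G G₁ G₂ : X → ℝ} (hG : ∀ x, G x = (G₁ x + G₂ x) / 2) :
    kineticCost w G ≤ (kineticCost w₁ G₁ + kineticCost w₂ G₂) / 2 := by
  refine iSup_le fun φ => ?_
  have h1 : energy (fun x y => (w₁ x y + w₂ x y) / 2) φ = (energy w₁ φ + energy w₂ φ) / 2 := by
    simp only [energy, ← mul_add, ← Finset.sum_add_distrib, Finset.mul_sum, Finset.sum_div]
    exact Finset.sum_congr rfl fun x _ => Finset.sum_congr rfl fun y _ => by ring
  have h2 : ∑ x, φ x * G x = (∑ x, φ x * G₁ x + ∑ x, φ x * G₂ x) / 2 := by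
    simp only [hG, ← Finset.sum_add_distrib, Finset.sum_div]
    exact Finset.sum_congr rfl fun x _ => by ring
  have h3 := energy_mono h φ
  rw [h1] at h3
  calc ENNReal.ofReal (2 * ∑ x, φ x * G x - energy w φ)
      ≤ ENNReal.ofReal (((2 * ∑ x, φ x * G₁ x - energy w₁ φ) +
          (2 * ∑ x, φ x * G₂ x - energy w₂ φ)) / 2) := ENNReal.ofReal_le_ofReal (by linarith)
    _ ≤ (ENNReal.ofReal (2 * ∑ x, φ x * G₁ x - energy w₁ φ) +
          ENNReal.ofReal (2 * ∑ x, φ x * G₂ x - energy w₂ φ)) / 2 := by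
        rw [ENNReal.ofReal_div_of_pos two_pos, ENNReal.ofReal_ofNat]
        exact ENNReal.div_le_div_right ENNReal.ofReal_add_le _
    _ ≤ _ := ENNReal.div_le_div_right
        (add_le_add (le_kineticCost w₁ G₁ φ) (le_kineticCost w₂ G₂ φ)) _

/-- A bound from testing with multiples of the indicator of a single point. -/
lemma sq_le_mul_kineticCost [DecidableEq X] {w : X → X → ℝ} {G : X → ℝ} {x : X} {A : ℝ}
    (hA : 0 < A) (h : energy w (Pi.single x 1) ≤ A) :
    ENNReal.ofReal (G x ^ 2) ≤ ENNReal.ofReal A * kineticCost w G := by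
  have h1 := le_kineticCost w G ((G x / A) • Pi.single x (1 : ℝ))
  rw [energy_smul] at h1
  have h2 : ∑ y, ((G x / A) • Pi.single x (1 : ℝ) : X → ℝ) y * G y = G x / A * G x := by
    rw [Finset.sum_eq_single x]
    · simp
    · intro y _ hy; simp [hy]
    · simp
  rw [h2] at h1
  calc ENNReal.ofReal (G x ^ 2) = ENNReal.ofReal A * ENNReal.ofReal (G x ^ 2 / A) := by
        rw [← ENNReal.ofReal_mul hA.le]; congr 1; field_simp
    _ ≤ _ := by
        gcongr
        refine le_trans (ENNReal.ofReal_le_ofReal ?_) h1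
        have := mul_le_mul_of_nonneg_left h (sq_nonneg (G x / A))
        have e : (G x / A) ^ 2 * A = G x ^ 2 / A := by field_simp
        have e' : G x / A * G x = G x ^ 2 / A := by ring
        linarith

/-- The weights `μ̂ (x, y) K (x, y) ϖ (x)`, extended to signed `μ` through its positive part. -/
def edgeWeight (K : Matrix X X ℝ) (ϖ μ : X → ℝ) (x y : X) : ℝ :=
  logMean (max (μ x) 0) (max (μ y) 0) * (K x y * ϖ x)

variable {K : Matrix X X ℝ} {ϖ : X → ℝ}

omit [Fintype X] in
lemma edgeWeight_of_mem {μ : X → ℝ} (hμ : μ ∈ densities X) (x y : X) :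
    edgeWeight K ϖ μ x y = mobility μ x y * (K x y * ϖ x) := by
  rw [edgeWeight, mobility, max_eq_left (hμ x), max_eq_left (hμ y)]

lemma gradNormSq_eq_energy {μ : X → ℝ} (hμ : μ ∈ densities X) (ψ : X → ℝ) :
    gradNormSq K ϖ μ ψ = energy (edgeWeight K ϖ μ) ψ := by
  simp only [gradNormSq, energy, edgeWeight_of_mem hμ, mul_assoc]

lemma edgeWeight_symm (hK : IsReversibleChain K ϖ) (μ : X → ℝ) (x y : X) :
    edgeWeight K ϖ μ x y = edgeWeight K ϖ μ y x := by
  rw [edgeWeight, edgeWeight, logMean_comm, hK.reversible x y]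

lemma IsReversibleChain.mul_nonneg (hK : IsReversibleChain K ϖ) (x y : X) : 0 ≤ K x y * ϖ x :=
  _root_.mul_nonneg (hK.irreducible.nonneg x y) (hK.nonneg x)

lemma edgeWeight_nonneg (hK : IsReversibleChain K ϖ) (μ : X → ℝ) (x y : X) :
    0 ≤ edgeWeight K ϖ μ x y :=
  mul_nonneg (logMean_nonneg (le_max_right _ _) (le_max_right _ _)) (hK.mul_nonneg x y)

omit [Fintype X] in
lemma continuous_edgeWeight (x y : X) : Continuous fun μ => edgeWeight K ϖ μ x y :=
  have h : Continuous fun μ : X → ℝ => (μ x, μ y) := by fun_prop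
  (continuous_logMean_max.comp h).mul continuous_const

lemma edgeWeight_midpoint (hK : IsReversibleChain K ϖ) {μ ν : X → ℝ} (hμ : μ ∈ densities X)
    (hν : ν ∈ densities X) (x y : X) : (edgeWeight K ϖ μ x y + edgeWeight K ϖ ν x y) / 2 ≤
      edgeWeight K ϖ (fun x => (μ x + ν x) / 2) x y := by
  have h : (fun x => (μ x + ν x) / 2) ∈ densities X := fun x => by
    have := hμ x; have := hν x; positivity
  rw [edgeWeight_of_mem hμ, edgeWeight_of_mem hν, edgeWeight_of_mem h, ← add_mul,
    mul_div_right_comm]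
  exact mul_le_mul_of_nonneg_right (logMean_midpoint (hμ x) (hμ y) (hν x) (hν y))
    (hK.mul_nonneg x y)

lemma edgeWeight_le (hK : IsReversibleChain K ϖ) {μ : X → ℝ} (hμ : μ ∈ densities X) {M : ℝ}
    (hM : ∀ x, μ x ≤ M) (x y : X) : edgeWeight K ϖ μ x y ≤ 2 * M * (K x y * ϖ x) := by
  rw [edgeWeight_of_mem hμ]
  refine mul_le_mul_of_nonneg_right ?_ (hK.mul_nonneg x y)
  exact (logMean_le_add (hμ x) (hμ y)).trans (by linarith [hM x, hM y])

lemma le_edgeWeight (hK : IsReversibleChain K ϖ) {μ : X → ℝ} {m : ℝ} (hm : 0 < m)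
    (hμ : ∀ x, m ≤ μ x) (x y : X) : m * (K x y * ϖ x) ≤ edgeWeight K ϖ μ x y :=
  mul_le_mul_of_nonneg_right (le_logMean hm (le_max_of_le_left (hμ x))
    (le_max_of_le_left (hμ y))) (hK.mul_nonneg x y)

omit [Fintype X] in
/-- A property that passes along the edges of an irreducible matrix holds everywhere as soon as it
holds somewhere. -/
lemma forall_of_irreducible (hK : K.IsIrreducible) {Q : X → Prop}
    (hQ : ∀ x y, 0 < K x y → Q x → Q y) {x : X} (hx : Q x) (y : X) : Q y := by
  let : Quiver X := Matrix.toQuiver K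
  obtain ⟨q, -⟩ := hK.connected x y
  induction q with
  | nil => exact hx
  | cons _ e ih => exact hQ _ _ e.down ih

lemma IsReversibleChain.pos (hK : IsReversibleChain K ϖ) (x : X) : 0 < ϖ x := by
  obtain ⟨y, -, hy⟩ := Finset.exists_ne_zero_of_sum_ne_zero
    (s := Finset.univ) (f := ϖ) (by rw [hK.sum_eq_one]; exact one_ne_zero)
  refine forall_of_irreducible hK.irreducible (Q := fun x => 0 < ϖ x) ?_
    (lt_of_le_of_ne (hK.nonneg y) (Ne.symm hy)) x
  intro u v huv hu
  have h1 := hK.reversible u v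
  refine lt_of_le_of_ne (hK.nonneg v) fun h => ?_
  rw [← h, mul_zero] at h1
  exact (mul_pos huv hu).ne' h1

/-- The Poisson equation of the chain itself is solvable for every right-hand side of mean zero,
since by irreducibility only constants have zero energy. -/
lemma IsReversibleChain.exists_lap_eq (hK : IsReversibleChain K ϖ) {G : X → ℝ}
    (hG : ∑ x, G x = 0) : ∃ χ, lap (fun x y => K x y * ϖ x) χ = G := by
  refine MarkovTransport.exists_lap_eq hK.reversible hK.mul_nonneg fun φ hφ => ?_
  have hz : ∀ x y, grad φ x y ^ 2 * (K x y * ϖ x) = 0 := by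
    have h0 : ∀ x y, 0 ≤ grad φ x y ^ 2 * (K x y * ϖ x) := fun x y =>
      _root_.mul_nonneg (sq_nonneg _) (hK.mul_nonneg x y)
    have h1 : ∑ x, ∑ y, grad φ x y ^ 2 * (K x y * ϖ x) = 0 := by
      simpa [energy] using hφ
    intro x y
    have h2 := (Finset.sum_eq_zero_iff_of_nonneg fun x _ =>
      Finset.sum_nonneg fun y _ => h0 x y).1 h1 x (Finset.mem_univ _)
    exact (Finset.sum_eq_zero_iff_of_nonneg fun y _ => h0 x y).1 h2 y (Finset.mem_univ _)
  rcases isEmpty_or_nonempty X with hX | ⟨⟨x₀⟩⟩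
  · simp
  have hconst : ∀ y, φ y = φ x₀ := by
    refine forall_of_irreducible hK.irreducible (Q := fun y => φ y = φ x₀) ?_ (x := x₀) rfl
    intro u v huv hu
    have := hz u v
    have hne : K u v * ϖ u ≠ 0 := (mul_pos huv (hK.pos u)).ne'
    have h3 : grad φ u v = 0 := by simpa [hne] using this
    rw [← hu]
    exact sub_eq_zero.1 h3
  simp only [hconst, ← Finset.mul_sum, hG, mul_zero]

/-- The source rate forced on a curve of velocity `f` by the balance of mass. -/
def sourceRate (ϖ f : X → ℝ) : ℝ := ∑ x, ϖ x * f x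

/-- The part of the velocity `f`, up to sign and weighted by `ϖ`, that has to be produced by
transport. -/
def transportRate (ϖ p f : X → ℝ) (x : X) : ℝ := ϖ x * (sourceRate ϖ f * p x - f x)

/-- The least action density of a curve passing through `μ` at velocity `f`. -/
def lagrangian (K : Matrix X X ℝ) (ϖ p : X → ℝ) (a b : ℝ) (μ f : X → ℝ) : ℝ≥0∞ :=
  ENNReal.ofReal (a ^ 2) * ENNReal.ofReal (sourceRate ϖ f ^ 2) +
    ENNReal.ofReal (b ^ 2) * kineticCost (edgeWeight K ϖ μ) (transportRate ϖ p f)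

variable {p : X → ℝ} {a b : ℝ}

lemma continuous_sourceRate : Continuous (sourceRate ϖ) := by
  unfold sourceRate; fun_prop

lemma continuous_transportRate : Continuous (transportRate ϖ p) := by
  refine continuous_pi fun x => ?_
  have := continuous_sourceRate (ϖ := ϖ)
  unfold transportRate
  fun_prop

lemma lowerSemicontinuous_lagrangian :
    LowerSemicontinuous fun q : (X → ℝ) × (X → ℝ) => lagrangian K ϖ p a b q.1 q.2 := by
  have hs := continuous_sourceRate (ϖ := ϖ)
  have hG := continuous_transportRate (ϖ := ϖ) (p := p)
  have hGx : ∀ x, Continuous fun q : (X → ℝ) × (X → ℝ) => transportRate ϖ p q.2 x := fun x =>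
    (continuous_apply x).comp (hG.comp continuous_snd)
  have hw : ∀ x y, Continuous fun q : (X → ℝ) × (X → ℝ) => edgeWeight K ϖ q.1 x y := fun x y =>
    (continuous_edgeWeight x y).comp continuous_fst
  have h1 : Continuous fun q : (X → ℝ) × (X → ℝ) =>
      ENNReal.ofReal (a ^ 2) * ENNReal.ofReal (sourceRate ϖ q.2 ^ 2) :=
    (ENNReal.continuous_const_mul ENNReal.ofReal_ne_top).comp
      (ENNReal.continuous_ofReal.comp ((hs.comp continuous_snd).pow 2))
  refine h1.lowerSemicontinuous.add ?_
  simp only [kineticCost, ENNReal.mul_iSup]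
  refine lowerSemicontinuous_iSup fun φ => Continuous.lowerSemicontinuous ?_
  refine (ENNReal.continuous_const_mul ENNReal.ofReal_ne_top).comp
    (ENNReal.continuous_ofReal.comp ?_)
  unfold energy
  refine Continuous.sub ?_ ?_
  · fun_prop
  · refine continuous_const.mul (continuous_finsetSum _ fun x _ => continuous_finsetSum _
      fun y _ => continuous_const.mul (hw x y))

/-- Joint (midpoint) convexity, which rests on the concavity of the logarithmic mean. -/
lemma lagrangian_midpoint (hK : IsReversibleChain K ϖ) {μ ν : X → ℝ} (hμ : μ ∈ densities X)
    (hν : ν ∈ densities X) (f g : X → ℝ) :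
    lagrangian K ϖ p a b (fun x => (μ x + ν x) / 2) (fun x => (f x + g x) / 2) ≤
      (lagrangian K ϖ p a b μ f + lagrangian K ϖ p a b ν g) / 2 := by
  have hs : sourceRate ϖ (fun x => (f x + g x) / 2) = (sourceRate ϖ f + sourceRate ϖ g) / 2 := by
    simp only [sourceRate, ← Finset.sum_add_distrib, Finset.sum_div]
    exact Finset.sum_congr rfl fun x _ => by ring
  have h1 : ENNReal.ofReal (sourceRate ϖ (fun x => (f x + g x) / 2) ^ 2) ≤
      (ENNReal.ofReal (sourceRate ϖ f ^ 2) + ENNReal.ofReal (sourceRate ϖ g ^ 2)) / 2 := by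
    rw [← ENNReal.ofReal_add (sq_nonneg _) (sq_nonneg _), ← ENNReal.ofReal_ofNat 2,
      ← ENNReal.ofReal_div_of_pos two_pos, hs]
    refine ENNReal.ofReal_le_ofReal ?_
    nlinarith [sq_nonneg (sourceRate ϖ f - sourceRate ϖ g)]
  have h2 := kineticCost_midpoint (edgeWeight_midpoint hK hμ hν)
    (G := transportRate ϖ p (fun x => (f x + g x) / 2)) (G₁ := transportRate ϖ p f)
    (G₂ := transportRate ϖ p g) (fun x => by simp only [transportRate, hs]; ring)
  calc _ ≤ ENNReal.ofReal (a ^ 2) * ((ENNReal.ofReal (sourceRate ϖ f ^ 2) +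
        ENNReal.ofReal (sourceRate ϖ g ^ 2)) / 2) + ENNReal.ofReal (b ^ 2) *
        ((kineticCost (edgeWeight K ϖ μ) (transportRate ϖ p f) +
          kineticCost (edgeWeight K ϖ ν) (transportRate ϖ p g)) / 2) :=
        add_le_add (by gcongr) (by gcongr)
    _ = _ := by
        simp only [lagrangian, div_eq_mul_inv]; ring

lemma sourceRate_sq_le (ha : 0 < a) (μ f : X → ℝ) : ENNReal.ofReal (sourceRate ϖ f ^ 2) ≤
    ENNReal.ofReal (1 / a ^ 2) * lagrangian K ϖ p a b μ f := by
  calc ENNReal.ofReal (sourceRate ϖ f ^ 2)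
      = ENNReal.ofReal (1 / a ^ 2) *
        (ENNReal.ofReal (a ^ 2) * ENNReal.ofReal (sourceRate ϖ f ^ 2)) := by
        rw [← ENNReal.ofReal_mul (by positivity), ← ENNReal.ofReal_mul (by positivity)]
        congr 1; field_simp
    _ ≤ _ := by gcongr; exact le_self_add

/-- On bounded sets of densities the Lagrangian controls the square of the velocity. -/
lemma exists_sq_le_lagrangian (hK : IsReversibleChain K ϖ) (ha : 0 < a) (hb : 0 < b) {M : ℝ}
    (hM : 0 ≤ M) : ∃ C : ℝ, ∀ μ ∈ densities X, (∀ x, μ x ≤ M) → ∀ (f : X → ℝ) (x : X),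
      ENNReal.ofReal (f x ^ 2) ≤ ENNReal.ofReal C * lagrangian K ϖ p a b μ f := by
  classical
  set A : X → ℝ := fun x => energy (fun x y => 2 * M * (K x y * ϖ x)) (Pi.single x 1) + 1 with hA
  have hA0 : ∀ x, 0 < A x := fun x => by
    have := energy_nonneg (w := fun x y => 2 * M * (K x y * ϖ x))
      (fun x y => mul_nonneg (by positivity) (hK.mul_nonneg x y)) (Pi.single x 1)
    positivity
  set c : X → ℝ := fun x => 2 * p x ^ 2 * (1 / a ^ 2) + 2 / ϖ x ^ 2 * (A x * (1 / b ^ 2)) with hc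
  have hc0 : ∀ x, 0 ≤ c x := fun x => by have := hA0 x; positivity
  refine ⟨∑ x, c x, fun μ hμ hμM f x => ?_⟩
  have hϖ := hK.pos x
  set L := lagrangian K ϖ p a b μ f with hL
  have h1 : ENNReal.ofReal (sourceRate ϖ f ^ 2) ≤ ENNReal.ofReal (1 / a ^ 2) * L :=
    sourceRate_sq_le ha μ f
  have h2 : ENNReal.ofReal (transportRate ϖ p f x ^ 2) ≤
      ENNReal.ofReal (A x * (1 / b ^ 2)) * L := by
    have hE : energy (edgeWeight K ϖ μ) (Pi.single x 1) ≤ A x :=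
      (energy_mono (edgeWeight_le hK hμ hμM) _).trans (by simp [hA])
    refine (sq_le_mul_kineticCost (hA0 x) hE).trans ?_
    rw [ENNReal.ofReal_mul (hA0 x).le, mul_assoc]
    gcongr
    calc _ = ENNReal.ofReal (1 / b ^ 2) * (ENNReal.ofReal (b ^ 2) *
          kineticCost (edgeWeight K ϖ μ) (transportRate ϖ p f)) := by
          rw [← mul_assoc, ← ENNReal.ofReal_mul (by positivity), one_div_mul_cancel (by positivity),
            ENNReal.ofReal_one, one_mul]
      _ ≤ _ := by gcongr; exact le_add_self
  have h3 : f x ^ 2 ≤ 2 * p x ^ 2 * sourceRate ϖ f ^ 2 +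
      2 / ϖ x ^ 2 * transportRate ϖ p f x ^ 2 := by
    have e : f x = sourceRate ϖ f * p x - transportRate ϖ p f x / ϖ x := by
      rw [transportRate]; field_simp; ring
    have e2 : 2 / ϖ x ^ 2 * transportRate ϖ p f x ^ 2 = 2 * (transportRate ϖ p f x / ϖ x) ^ 2 := by
      ring
    rw [e2]
    have e3 := congrArg (fun z => z ^ 2) e
    rw [e3]
    nlinarith [sq_nonneg (sourceRate ϖ f * p x + transportRate ϖ p f x / ϖ x)]
  calc ENNReal.ofReal (f x ^ 2)
      ≤ ENNReal.ofReal (2 * p x ^ 2) * ENNReal.ofReal (sourceRate ϖ f ^ 2) +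
        ENNReal.ofReal (2 / ϖ x ^ 2) * ENNReal.ofReal (transportRate ϖ p f x ^ 2) := by
        rw [← ENNReal.ofReal_mul (by positivity), ← ENNReal.ofReal_mul (by positivity),
          ← ENNReal.ofReal_add (by positivity) (by positivity)]
        exact ENNReal.ofReal_le_ofReal h3
    _ ≤ ENNReal.ofReal (2 * p x ^ 2) * (ENNReal.ofReal (1 / a ^ 2) * L) +
        ENNReal.ofReal (2 / ϖ x ^ 2) * (ENNReal.ofReal (A x * (1 / b ^ 2)) * L) := by gcongr
    _ = ENNReal.ofReal (c x) * L := by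
        have := hA0 x
        rw [← mul_assoc, ← mul_assoc, ← ENNReal.ofReal_mul (by positivity),
          ← ENNReal.ofReal_mul (by positivity), ← add_mul,
          ← ENNReal.ofReal_add (by positivity) (by positivity)]
    _ ≤ _ := by
        gcongr
        exact Finset.single_le_sum (fun i _ => hc0 i) (Finset.mem_univ x)

end Lagrangian

/-! ### Curves of densities and their velocities -/

section Curves

variable {X : Type*} [Fintype X]

open AbsolutelyContinuousOnInterval in
lemma absolutelyContinuousOnInterval_pi {μ : ℝ → X → ℝ} {g : X → ℝ → ℝ} {c d : ℝ}
    (hg : ∀ x, AbsolutelyContinuousOnInterval (g x) c d)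
    (h : ∀ t ∈ uIcc c d, ∀ x, μ t x = g x t) : AbsolutelyContinuousOnInterval μ c d := by
  have hsum : Tendsto (fun E : ℕ × (ℕ → ℝ × ℝ) => ∑ x, ∑ i ∈ Finset.range E.1,
      Dist.dist (g x (E.2 i).1) (g x (E.2 i).2))
      (totalLengthFilter ⊓ 𝓟 (disjWithin c d)) (𝓝 0) := by
    simpa using tendsto_finsetSum Finset.univ fun x _ => hg x
  refine squeeze_zero' (Eventually.of_forall fun E => Finset.sum_nonneg fun i _ => dist_nonneg)
    ?_ hsum
  filter_upwards [mem_inf_of_right (mem_principal_self _)] with E hE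
  rw [Finset.sum_comm]
  refine Finset.sum_le_sum fun i hi => ?_
  refine (dist_pi_le_iff (Finset.sum_nonneg fun x _ => dist_nonneg)).2 fun x => ?_
  rw [h _ (hE.1 i hi).1, h _ (hE.1 i hi).2]
  exact Finset.single_le_sum (f := fun x => Dist.dist (g x (E.2 i).1) (g x (E.2 i).2))
    (fun _ _ => dist_nonneg) (Finset.mem_univ x)

lemma absolutelyContinuousOnInterval_apply {μ : ℝ → X → ℝ} {c d : ℝ}
    (h : AbsolutelyContinuousOnInterval μ c d) (x : X) :
    AbsolutelyContinuousOnInterval (fun t => μ t x) c d :=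
  squeeze_zero (fun _ => Finset.sum_nonneg fun _ _ => dist_nonneg)
    (fun _ => Finset.sum_le_sum fun _ _ => dist_le_pi_dist _ _ x) h

/-- Lebesgue measure on the time interval `[0, 1]`. -/
abbrev unitTime : Measure ℝ := volume.restrict (Icc (0 : ℝ) 1)

/-- The curve starting at `μ₀` with velocity `f`. Integration against `unitTime` makes only the
values of `f` on `[0, 1]` matter. -/
def curve (μ₀ : X → ℝ) (f : ℝ → X → ℝ) (t : ℝ) (x : X) : ℝ :=
  μ₀ x + ∫ s in (0 : ℝ)..t, f s x ∂unitTime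

/-- `f` is the velocity of a curve of densities leading from `μ₀` to `μ₁`. -/
structure IsVelocity (μ₀ μ₁ : X → ℝ) (f : ℝ → X → ℝ) : Prop where
  measurable : Measurable f
  integrable : ∀ x, Integrable (fun t => f t x) unitTime
  mem_densities : ∀ t ∈ Icc (0 : ℝ) 1, curve μ₀ f t ∈ densities X
  finish : curve μ₀ f 1 = μ₁

/-- The least action of the curve with starting point `μ₀` and velocity `f`. -/
def cost (K : Matrix X X ℝ) (ϖ p : X → ℝ) (a b : ℝ) (μ₀ : X → ℝ) (f : ℝ → X → ℝ) : ℝ≥0∞ :=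
  ∫⁻ t, lagrangian K ϖ p a b (curve μ₀ f t) (f t) ∂unitTime

variable {K : Matrix X X ℝ} {ϖ p : X → ℝ} {a b : ℝ} {μ₀ μ₁ : X → ℝ} {f g : ℝ → X → ℝ}

omit [Fintype X] in
lemma curve_eq {t : ℝ} (ht : t ∈ Icc (0 : ℝ) 1) (x : X) :
    curve μ₀ f t x = μ₀ x + ∫ s in (0 : ℝ)..t, f s x := by
  rw [curve, intervalIntegral.integral_of_le ht.1, intervalIntegral.integral_of_le ht.1,
    Measure.restrict_restrict measurableSet_Ioc, inter_eq_left.2]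
  exact fun s hs => ⟨hs.1.le, hs.2.trans ht.2⟩

omit [Fintype X] in
lemma curve_zero : curve μ₀ f 0 = μ₀ := by
  funext x; simp [curve]

omit [Fintype X] in
lemma continuous_curve (hf : ∀ x, Integrable (fun t => f t x) unitTime) :
    Continuous (curve μ₀ f) := by
  refine continuous_pi fun x => continuous_const.add ?_
  exact intervalIntegral.continuous_primitive (fun _ _ => (hf x).intervalIntegrable) 0

omit [Fintype X] in
lemma curve_congr (h : f =ᵐ[unitTime] g) : curve μ₀ f = curve μ₀ g := by
  funext t x
  rw [curve, curve, intervalIntegral.integral_congr_ae]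
  filter_upwards [h] with s hs _
  rw [hs]

lemma cost_congr (h : f =ᵐ[unitTime] g) : cost K ϖ p a b μ₀ f = cost K ϖ p a b μ₀ g := by
  rw [cost, cost, curve_congr h]
  refine lintegral_congr_ae ?_
  filter_upwards [h] with t ht
  rw [ht]

omit [Fintype X] in
lemma IsVelocity.congr (hf : IsVelocity μ₀ μ₁ f) (hg : Measurable g) (h : f =ᵐ[unitTime] g) :
    IsVelocity μ₀ μ₁ g where
  measurable := hg
  integrable x := (hf.integrable x).congr (by filter_upwards [h] with t ht; rw [ht])
  mem_densities := by rw [← curve_congr h]; exact hf.mem_densities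
  finish := by rw [← curve_congr h]; exact hf.finish

omit [Fintype X] in
lemma curve_midpoint (hf : ∀ x, Integrable (fun t => f t x) unitTime)
    (hg : ∀ x, Integrable (fun t => g t x) unitTime) (t : ℝ) :
    curve μ₀ (fun t x => (f t x + g t x) / 2) t =
      fun x => (curve μ₀ f t x + curve μ₀ g t x) / 2 := by
  funext x
  simp only [curve]
  rw [intervalIntegral.integral_div, intervalIntegral.integral_add (hf x).intervalIntegrable
    (hg x).intervalIntegrable]
  ring

lemma measurable_lagrangian :
    Measurable fun q : (X → ℝ) × (X → ℝ) => lagrangian K ϖ p a b q.1 q.2 :=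
  lowerSemicontinuous_lagrangian.measurable

lemma IsVelocity.measurable_lagrangian_curve (hf : IsVelocity μ₀ μ₁ f) :
    Measurable fun t => lagrangian K ϖ p a b (curve μ₀ f t) (f t) := by
  have h1 : Measurable fun t => (curve μ₀ f t, f t) :=
    (continuous_curve hf.integrable).measurable.prodMk hf.measurable
  have h2 := Measurable.comp (g := fun q : (X → ℝ) × (X → ℝ) => lagrangian K ϖ p a b q.1 q.2)
    measurable_lagrangian h1
  exact h2

omit [Fintype X] in
lemma IsVelocity.midpoint (hf : IsVelocity μ₀ μ₁ f) (hg : IsVelocity μ₀ μ₁ g) :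
    IsVelocity μ₀ μ₁ (fun t x => (f t x + g t x) / 2) where
  measurable := measurable_pi_lambda _ fun x =>
    (((measurable_pi_apply x).comp hf.measurable).add
      ((measurable_pi_apply x).comp hg.measurable)).div_const 2
  integrable x := ((hf.integrable x).add (hg.integrable x)).div_const 2
  mem_densities t ht x := by
    rw [curve_midpoint hf.integrable hg.integrable]
    have := hf.mem_densities t ht x
    have := hg.mem_densities t ht x
    positivity
  finish := by
    rw [curve_midpoint hf.integrable hg.integrable, hf.finish, hg.finish]
    funext x; ring

lemma IsVelocity.cost_midpoint (hK : IsReversibleChain K ϖ) (hf : IsVelocity μ₀ μ₁ f)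
    (hg : IsVelocity μ₀ μ₁ g) : cost K ϖ p a b μ₀ (fun t x => (f t x + g t x) / 2) ≤
      (cost K ϖ p a b μ₀ f + cost K ϖ p a b μ₀ g) / 2 := by
  have h : ∀ᵐ t ∂unitTime, lagrangian K ϖ p a b
      (curve μ₀ (fun t x => (f t x + g t x) / 2) t) (fun x => (f t x + g t x) / 2) ≤
      2⁻¹ * (lagrangian K ϖ p a b (curve μ₀ f t) (f t) +
        lagrangian K ϖ p a b (curve μ₀ g t) (g t)) := by
    filter_upwards [ae_restrict_mem measurableSet_Icc] with t ht
    rw [curve_midpoint hf.integrable hg.integrable, mul_comm, ← div_eq_mul_inv]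
    exact lagrangian_midpoint hK (hf.mem_densities t ht) (hg.mem_densities t ht) _ _
  refine (lintegral_mono_ae h).trans ?_
  rw [lintegral_const_mul' _ _ (by simp), lintegral_add_left hf.measurable_lagrangian_curve,
    mul_comm, ← div_eq_mul_inv]
  rfl

/-- Curves of bounded cost have bounded mass, as the source alone changes the mass. -/
lemma exists_curve_le (hK : IsReversibleChain K ϖ) (ha : 0 < a) (h₀ : μ₀ ∈ densities X)
    {R : ℝ≥0∞} (hR : R ≠ ∞) : ∃ M : ℝ, 0 ≤ M ∧ ∀ f, IsVelocity μ₀ μ₁ f →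
      cost K ϖ p a b μ₀ f ≤ R → ∀ t ∈ Icc (0 : ℝ) 1, ∀ x, curve μ₀ f t x ≤ M := by
  set B : ℝ := (1 + ENNReal.ofReal (1 / a ^ 2) * R).toReal with hB
  have hB0 : 0 ≤ B := ENNReal.toReal_nonneg
  have hm : 0 ≤ ∑ x, ϖ x * μ₀ x := Finset.sum_nonneg fun x _ => mul_nonneg (hK.nonneg x) (h₀ x)
  have hc : ∀ x, 0 ≤ (∑ x, ϖ x * μ₀ x + B) / ϖ x := fun x =>
    div_nonneg (by positivity) (hK.nonneg x)
  refine ⟨∑ x, (∑ x, ϖ x * μ₀ x + B) / ϖ x, Finset.sum_nonneg fun x _ => hc x,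
    fun f hf hfR t ht x => ?_⟩
  refine le_trans ?_ (Finset.single_le_sum (fun x _ => hc x) (Finset.mem_univ x))
  rw [le_div_iff₀ (hK.pos x), mul_comm]
  have hs : Integrable (fun t => sourceRate ϖ (f t)) unitTime :=
    integrable_finsetSum _ fun x _ => (hf.integrable x).const_mul _
  have h1 : ∑ x, ϖ x * curve μ₀ f t x =
      ∑ x, ϖ x * μ₀ x + ∫ s in (0 : ℝ)..t, sourceRate ϖ (f s) ∂unitTime := by
    simp only [sourceRate]
    rw [intervalIntegral.integral_finsetSum fun x _ =>
      ((hf.integrable x).const_mul _).intervalIntegrable, ← Finset.sum_add_distrib]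
    refine Finset.sum_congr rfl fun x _ => ?_
    rw [intervalIntegral.integral_const_mul, curve, mul_add]
  have h2 : ∫ s in (0 : ℝ)..t, sourceRate ϖ (f s) ∂unitTime ≤ B := by
    calc _ ≤ ∫ s in (0 : ℝ)..t, ‖sourceRate ϖ (f s)‖ ∂unitTime :=
          (Real.le_norm_self _).trans (intervalIntegral.norm_integral_le_integral_norm ht.1)
      _ ≤ ∫ s, ‖sourceRate ϖ (f s)‖ ∂unitTime := by
          rw [intervalIntegral.integral_of_le ht.1]
          exact setIntegral_le_integral hs.norm (Eventually.of_forall fun _ => norm_nonneg _)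
      _ ≤ B := by
          rw [integral_norm_eq_lintegral_enorm hs.1]
          refine ENNReal.toReal_mono (by finiteness) ?_
          calc ∫⁻ s, ‖sourceRate ϖ (f s)‖ₑ ∂unitTime
              ≤ ∫⁻ s, (1 + ENNReal.ofReal (1 / a ^ 2) *
                  lagrangian K ϖ p a b (curve μ₀ f s) (f s)) ∂unitTime := by
                refine lintegral_mono fun s => ?_
                refine le_trans ?_ (add_le_add le_rfl (sourceRate_sq_le ha (curve μ₀ f s) (f s)))
                rw [← ENNReal.ofReal_one, ← ENNReal.ofReal_add zero_le_one (sq_nonneg _),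
                  Real.enorm_eq_ofReal_abs]
                refine ENNReal.ofReal_le_ofReal ?_
                rw [← sq_abs]
                nlinarith [sq_nonneg (|sourceRate ϖ (f s)| - 1),
                  sq_nonneg (|sourceRate ϖ (f s)|)]
            _ = 1 + ENNReal.ofReal (1 / a ^ 2) * cost K ϖ p a b μ₀ f := by
                rw [lintegral_add_left measurable_const,
                  lintegral_const_mul' _ _ ENNReal.ofReal_ne_top]
                simp [cost]
            _ ≤ _ := by gcongr
  have h3 : ϖ x * curve μ₀ f t x ≤ ∑ x, ϖ x * curve μ₀ f t x :=
    Finset.single_le_sum (f := fun x => ϖ x * curve μ₀ f t x)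
      (fun x _ => mul_nonneg (hK.nonneg x) (hf.mem_densities t ht x)) (Finset.mem_univ x)
  linarith

lemma exists_lintegral_sq_le (hK : IsReversibleChain K ϖ) (ha : 0 < a) (hb : 0 < b)
    (h₀ : μ₀ ∈ densities X) {R : ℝ≥0∞} (hR : R ≠ ∞) : ∃ C : ℝ≥0∞, C ≠ ∞ ∧
      ∀ f, IsVelocity μ₀ μ₁ f → cost K ϖ p a b μ₀ f ≤ R →
        ∀ x, ∫⁻ t, ENNReal.ofReal (f t x ^ 2) ∂unitTime ≤ C := by
  obtain ⟨M, hM, hcurve⟩ := exists_curve_le (p := p) (b := b) (μ₁ := μ₁) hK ha h₀ hR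
  obtain ⟨C, hC⟩ := exists_sq_le_lagrangian (p := p) hK ha hb hM
  refine ⟨ENNReal.ofReal C * R, by finiteness, fun f hf hfR x => ?_⟩
  calc _ ≤ ∫⁻ t, ENNReal.ofReal C * lagrangian K ϖ p a b (curve μ₀ f t) (f t) ∂unitTime := by
        refine lintegral_mono_ae ?_
        filter_upwards [ae_restrict_mem measurableSet_Icc] with t ht
        exact hC _ (hf.mem_densities t ht) (hcurve f hf hfR t ht) _ x
    _ = ENNReal.ofReal C * cost K ϖ p a b μ₀ f := lintegral_const_mul' _ _ ENNReal.ofReal_ne_top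
    _ ≤ _ := by gcongr

/-! ### Admissible triples and velocities -/

lemma mass_eq (hp : p ∈ posDensities X) : mass ϖ p = ∑ x, ϖ x * p x :=
  Finset.sum_congr rfl fun x _ => by rw [abs_of_pos (hp x)]

lemma lap_edgeWeight {μ : X → ℝ} (hμ : μ ∈ densities X) (ψ : X → ℝ) (x : X) :
    lap (edgeWeight K ϖ μ) ψ x = ϖ x * ∑ y, grad ψ x y * mobility μ x y * K x y := by
  rw [lap, Finset.mul_sum]
  refine Finset.sum_congr rfl fun y _ => ?_
  rw [edgeWeight_of_mem hμ]; ring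

lemma sum_lap {w : X → X → ℝ} (hw : ∀ x y, w x y = w y x) (ψ : X → ℝ) : ∑ x, lap w ψ x = 0 := by
  simpa [grad] using sum_mul_lap hw (fun _ => 1) ψ

/-- At a time where the continuity equation holds, the source is the source rate of the velocity and
the potential is the one realising the Lagrangian. -/
lemma lagrangian_eq_of_continuity (hK : IsReversibleChain K ϖ) (hp : p ∈ posDensities X)
    (hp1 : mass ϖ p = 1) {μ ψ d : X → ℝ} {h : ℝ} (hμ : μ ∈ densities X)
    (hd : ∀ x, d x + ∑ y, grad ψ x y * mobility μ x y * K x y = h * p x) :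
    lagrangian K ϖ p a b μ d = ENNReal.ofReal (a ^ 2) * ENNReal.ofReal (h ^ 2) +
      ENNReal.ofReal (b ^ 2) * ENNReal.ofReal (gradNormSq K ϖ μ ψ) := by
  have hl : ∀ x, lap (edgeWeight K ϖ μ) ψ x = ϖ x * (h * p x - d x) := fun x => by
    rw [lap_edgeWeight hμ, ← hd x]; ring
  have hs : sourceRate ϖ d = h := by
    have h0 := sum_lap (edgeWeight_symm hK μ) ψ
    simp only [hl, mul_sub, Finset.sum_sub_distrib] at h0
    have h1 : ∑ x, ϖ x * (h * p x) = h * ∑ x, ϖ x * p x := by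
      rw [Finset.mul_sum]; exact Finset.sum_congr rfl fun x _ => by ring
    rw [h1, ← mass_eq hp, hp1] at h0
    rw [sourceRate]; linarith
  have hG : transportRate ϖ p d = lap (edgeWeight K ϖ μ) ψ := by
    funext x; rw [hl, transportRate, hs]
  rw [lagrangian, hs, hG, kineticCost_lap (edgeWeight_symm hK μ) (edgeWeight_nonneg hK μ),
    gradNormSq_eq_energy hμ]

lemma action_eq {μ ψ : ℝ → X → ℝ} {h : ℝ → ℝ} (hh : Measurable ((Icc (0 : ℝ) 1).domRestrict h)) :
    action K ϖ a b μ ψ h = ∫⁻ t, (ENNReal.ofReal (a ^ 2) * ENNReal.ofReal (h t ^ 2) +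
      ENNReal.ofReal (b ^ 2) * ENNReal.ofReal (gradNormSq K ϖ (μ t) (ψ t))) ∂unitTime := by
  have hm : AEMeasurable h unitTime :=
    aemeasurable_restrict_of_measurable_subtype measurableSet_Icc hh
  rw [lintegral_add_left' ((hm.pow_const 2).ennreal_ofReal.const_mul _),
    lintegral_const_mul' _ _ ENNReal.ofReal_ne_top, lintegral_const_mul' _ _ ENNReal.ofReal_ne_top,
    action]

/-- The velocity of an admissible triple; the least action of its curve is that of the triple. -/
lemma IsAdmissible.exists_velocity (hK : IsReversibleChain K ϖ) (hp : p ∈ posDensities X)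
    (hp1 : mass ϖ p = 1) {μ ψ : ℝ → X → ℝ} {h : ℝ → ℝ}
    (H : IsAdmissible K p μ₀ μ₁ μ ψ h) :
    ∃ f, IsVelocity μ₀ μ₁ f ∧ cost K ϖ p a b μ₀ f = action K ϖ a b μ ψ h := by
  set f : ℝ → X → ℝ := fun t x => deriv (fun s => μ s x) t with hf
  have hac := absolutelyContinuousOnInterval_apply H.absolutelyContinuous
  have hint : ∀ x, Integrable (fun t => f t x) unitTime := fun x => by
    rw [← IntegrableOn, ← intervalIntegrable_iff_integrableOn_Icc_of_le zero_le_one]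
    exact (hac x).intervalIntegrable_deriv
  have hcurve : ∀ t ∈ Icc (0 : ℝ) 1, curve μ₀ f t = μ t := by
    intro t ht
    funext x
    have hsub : uIcc 0 t ⊆ uIcc (0 : ℝ) 1 := by
      rw [uIcc_of_le ht.1, uIcc_of_le zero_le_one]; exact Icc_subset_Icc_right ht.2
    rw [curve_eq ht, ((hac x).mono hsub).integral_deriv_eq_sub, H.start]
    ring
  refine ⟨f, ⟨measurable_pi_lambda _ fun x => measurable_deriv _, hint, ?_, ?_⟩, ?_⟩
  · intro t ht; rw [hcurve t ht]; exact H.mem_densities t ht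
  · rw [hcurve 1 (by simp), H.finish]
  · rw [action_eq H.measurable_source, cost]
    refine lintegral_congr_ae ?_
    filter_upwards [H.continuity_equation, ae_restrict_mem measurableSet_Icc] with t ht1 ht
    rw [hcurve t ht]
    refine lagrangian_eq_of_continuity hK hp hp1 (H.mem_densities t ht) fun x => ?_
    obtain ⟨d, hd, hd2⟩ := ht1 x
    rw [← hd2]
    congr 1
    exact hd.deriv

omit [Fintype X] in
lemma ae_hasDerivAt_curve [Finite X] (hf : ∀ x, Integrable (fun t => f t x) unitTime) :
    ∀ᵐ t ∂unitTime, ∀ x, HasDerivAt (fun s => curve μ₀ f s x) (f t x) t := by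
  rw [ae_all_iff]
  intro x
  have hi : IntervalIntegrable (fun t => f t x) volume 0 1 :=
    (intervalIntegrable_iff_integrableOn_Icc_of_le zero_le_one).2 (hf x)
  rw [unitTime, ← restrict_Ioo_eq_restrict_Icc]
  filter_upwards [ae_restrict_of_ae hi.ae_hasDerivAt_integral, ae_restrict_mem measurableSet_Ioo]
    with t ht1 ht
  rw [uIcc_of_le zero_le_one] at ht1
  refine ((ht1 (Ioo_subset_Icc_self ht) 0 (by simp)).const_add (μ₀ x)).congr_of_eventuallyEq ?_
  filter_upwards [Ioo_mem_nhds ht.1 ht.2] with s hs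
  exact curve_eq (Ioo_subset_Icc_self hs) x

/-- A velocity of finite cost comes from an admissible triple. -/
lemma IsVelocity.exists_admissible (hK : IsReversibleChain K ϖ) (hb : 0 < b)
    (hp : p ∈ posDensities X) (hp1 : mass ϖ p = 1) (hf : IsVelocity μ₀ μ₁ f)
    (hfin : cost K ϖ p a b μ₀ f ≠ ∞) : ∃ μ ψ h, IsAdmissible K p μ₀ μ₁ μ ψ h ∧
      action K ϖ a b μ ψ h = cost K ϖ p a b μ₀ f := by
  have hcont := continuous_curve (μ₀ := μ₀) hf.integrable
  have hGm : Measurable fun t => transportRate ϖ p (f t) :=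
    continuous_transportRate.measurable.comp hf.measurable
  obtain ⟨ψ, hψ, hlap⟩ := exists_measurable_potential
    (w := fun t => edgeWeight K ϖ (curve μ₀ f t))
    (fun x y => ((continuous_edgeWeight x y).comp hcont).measurable) hGm
  have hsm : Measurable fun t => sourceRate ϖ (f t) :=
    continuous_sourceRate.measurable.comp hf.measurable
  have hkin : ∀ᵐ t ∂unitTime, kineticCost (edgeWeight K ϖ (curve μ₀ f t))
      (transportRate ϖ p (f t)) ≠ ∞ := by
    filter_upwards [ae_lt_top hf.measurable_lagrangian_curve hfin] with t ht htop
    rw [lagrangian, htop, ENNReal.mul_top (by simpa using hb.ne'), add_top] at ht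
    exact lt_irrefl _ ht
  have hce : ∀ᵐ t ∂unitTime, ∀ x, f t x +
      ∑ y, grad (ψ t) x y * mobility (curve μ₀ f t) x y * K x y = sourceRate ϖ (f t) * p x := by
    filter_upwards [hkin, ae_restrict_mem measurableSet_Icc] with t ht htI x
    have h1 := congrFun (hlap t (edgeWeight_symm hK _) (edgeWeight_nonneg hK _) ht) x
    rw [lap_edgeWeight (hf.mem_densities t htI), transportRate] at h1
    rw [mul_left_cancel₀ (hK.pos x).ne' h1]
    ring
  have H : IsAdmissible K p μ₀ μ₁ (curve μ₀ f) ψ (fun t => sourceRate ϖ (f t)) :=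
    { mem_densities := hf.mem_densities
      absolutelyContinuous := by
        refine absolutelyContinuousOnInterval_pi
          (g := fun x t => μ₀ x + ∫ s in (0 : ℝ)..t, f s x) (fun x => ?_) fun t ht x =>
            curve_eq (by rwa [uIcc_of_le zero_le_one] at ht) x
        have hi : IntervalIntegrable (fun t => f t x) volume 0 1 :=
          (intervalIntegrable_iff_integrableOn_Icc_of_le zero_le_one).2 (hf.integrable x)
        refine AbsolutelyContinuousOnInterval.add (f := fun _ => μ₀ x) ?_
          (hi.absolutelyContinuousOnInterval_intervalIntegral (by simp))
        exact contDiffOn_const.absolutelyContinuousOnInterval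
      measurable_potential := hψ.comp measurable_subtype_coe
      measurable_source := hsm.comp measurable_subtype_coe
      continuity_equation := by
        filter_upwards [hce, ae_hasDerivAt_curve hf.integrable] with t h1 h2 x
        exact ⟨f t x, h2 x, h1 x⟩
      start := curve_zero
      finish := hf.finish }
  refine ⟨_, _, _, H, ?_⟩
  rw [action_eq H.measurable_source, cost]
  refine lintegral_congr_ae ?_
  filter_upwards [hce, ae_restrict_mem measurableSet_Icc] with t h1 ht
  exact (lagrangian_eq_of_continuity hK hp hp1 (hf.mem_densities t ht) h1).symm

/-! ### A curve of finite action -/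

/-- The curve `(1 - s) μ₀ + s μ₁ + t (1 - t) p` with `s = 3 t ^ 2 - 2 t ^ 3` has finite cost: the
source lifts the density by `t (1 - t) p`, and `s` is so flat at the end times that its squared
velocity compensates the degeneracy of the mobility there. -/
lemma exists_velocity_cost_ne_top (hK : IsReversibleChain K ϖ) (hp : p ∈ posDensities X)
    (hp1 : mass ϖ p = 1) (h₀ : μ₀ ∈ densities X) (h₁ : μ₁ ∈ densities X) :
    ∃ f, IsVelocity μ₀ μ₁ f ∧ cost K ϖ p a b μ₀ f ≠ ∞ := by
  obtain ⟨y, -, -⟩ := Finset.exists_ne_zero_of_sum_ne_zero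
    (s := Finset.univ) (f := ϖ) (by rw [hK.sum_eq_one]; exact one_ne_zero)
  have : Nonempty X := ⟨y⟩
  obtain ⟨x₀, hx₀⟩ := Finite.exists_min p
  set f : ℝ → X → ℝ := fun t x => 6 * (t * (1 - t)) * (μ₁ x - μ₀ x) + (1 - 2 * t) * p x with hf
  have hfc : ∀ x, Continuous fun t => f t x := fun x => by simp only [hf]; fun_prop
  have hcurve : ∀ t ∈ Icc (0 : ℝ) 1, ∀ x, curve μ₀ f t x =
      μ₀ x + (3 * t ^ 2 - 2 * t ^ 3) * (μ₁ x - μ₀ x) + t * (1 - t) * p x := by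
    intro t ht x
    have hd : ∀ s ∈ uIcc 0 t, HasDerivAt (fun s : ℝ =>
        (3 * s ^ 2 - 2 * s ^ 3) * (μ₁ x - μ₀ x) + (s - s ^ 2) * p x) (f s x) s := by
      intro s _
      have h := ((((hasDerivAt_pow 2 s).const_mul 3).sub
        ((hasDerivAt_pow 3 s).const_mul 2)).mul_const (μ₁ x - μ₀ x)).add
        (((hasDerivAt_id s).sub (hasDerivAt_pow 2 s)).mul_const (p x))
      refine h.congr_deriv ?_
      simp only [hf]; push_cast; ring
    rw [curve_eq ht, intervalIntegral.integral_eq_sub_of_hasDerivAt hd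
      ((hfc x).intervalIntegrable _ _)]
    ring
  have hlow : ∀ t ∈ Icc (0 : ℝ) 1, ∀ x, t * (1 - t) * p x₀ ≤ curve μ₀ f t x := by
    rintro t ⟨ht0, ht1⟩ x
    rw [hcurve t ⟨ht0, ht1⟩]
    have hs0 : 0 ≤ 3 * t ^ 2 - 2 * t ^ 3 := by
      nlinarith [mul_nonneg (sq_nonneg t) (sub_nonneg.2 ht1), sq_nonneg t]
    have hs1 : 0 ≤ 1 - (3 * t ^ 2 - 2 * t ^ 3) := by
      have : 1 - (3 * t ^ 2 - 2 * t ^ 3) = (1 - t) ^ 2 * (1 + 2 * t) := by ring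
      rw [this]; positivity
    have e1 := mul_nonneg hs0 (h₁ x)
    have e2 := mul_nonneg hs1 (h₀ x)
    have e3 := mul_le_mul_of_nonneg_left (hx₀ x) (mul_nonneg ht0 (sub_nonneg.2 ht1))
    nlinarith
  refine ⟨f, ⟨measurable_pi_lambda _ fun x => (hfc x).measurable, fun x =>
    (hfc x).integrableOn_Icc, fun t ht x => ?_, ?_⟩, ?_⟩
  · exact (mul_nonneg (mul_nonneg ht.1 (sub_nonneg.2 ht.2)) (hp x₀).le).trans (hlow t ht x)
  · funext x; rw [hcurve 1 (by simp)]; ring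
  set m := ∑ x, ϖ x * (μ₁ x - μ₀ x) with hm
  have hsource : ∀ t, sourceRate ϖ (f t) = 6 * (t * (1 - t)) * m + (1 - 2 * t) := by
    intro t
    have : ∑ x, ϖ x * p x = 1 := by rw [← mass_eq hp, hp1]
    rw [show 6 * (t * (1 - t)) * m + (1 - 2 * t) =
        6 * (t * (1 - t)) * m + (1 - 2 * t) * ∑ x, ϖ x * p x by rw [this, mul_one], hm,
      sourceRate, Finset.mul_sum, Finset.mul_sum, ← Finset.sum_add_distrib]
    exact Finset.sum_congr rfl fun x _ => by simp only [hf]; ring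
  obtain ⟨χ, hχ⟩ := hK.exists_lap_eq (G := fun x => ϖ x * (m * p x - (μ₁ x - μ₀ x))) (by
    have h1 : ∑ x, ϖ x * p x = 1 := by rw [← mass_eq hp, hp1]
    have h2 : ∑ x, ϖ x * (m * p x - (μ₁ x - μ₀ x)) =
        m * ∑ x, ϖ x * p x - ∑ x, ϖ x * (μ₁ x - μ₀ x) := by
      rw [Finset.mul_sum, ← Finset.sum_sub_distrib]
      exact Finset.sum_congr rfl fun x _ => by ring
    rw [h2, h1, ← hm]; ring)
  set k : X → X → ℝ := fun x y => K x y * ϖ x with hk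
  have hE : 0 ≤ energy k χ := energy_nonneg hK.mul_nonneg χ
  have hbound : ∀ t ∈ Ioo (0 : ℝ) 1, lagrangian K ϖ p a b (curve μ₀ f t) (f t) ≤
      ENNReal.ofReal (a ^ 2) * ENNReal.ofReal ((6 * |m| + 1) ^ 2) +
        ENNReal.ofReal (b ^ 2) * ENNReal.ofReal (36 / p x₀ * energy k χ) := by
    rintro t ⟨ht0, ht1⟩
    have ht2 : 0 < t * (1 - t) := mul_pos ht0 (sub_pos.2 ht1)
    have ht3 : t * (1 - t) ≤ 1 := by nlinarith
    have hc : 0 < t * (1 - t) * p x₀ := mul_pos ht2 (hp x₀)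
    refine add_le_add (mul_le_mul_right (ENNReal.ofReal_le_ofReal ?_) _)
      (mul_le_mul_right ?_ _)
    · rw [hsource, sq_le_sq, abs_of_nonneg (by positivity : 0 ≤ 6 * |m| + 1)]
      refine (abs_add_le _ _).trans (add_le_add ?_ (abs_le.2 ⟨by linarith, by linarith⟩))
      rw [abs_mul, abs_of_pos (by positivity)]
      nlinarith [abs_nonneg m]
    · have hG : transportRate ϖ p (f t) = lap (fun x y => t * (1 - t) * p x₀ * k x y)
          ((6 / p x₀) • χ) := by
        have hlap : ∀ c : ℝ, lap (fun x y => c * k x y) ((6 / p x₀) • χ) =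
            c • lap k ((6 / p x₀) • χ) := by
          intro c; funext x
          simp only [lap, Pi.smul_apply, smul_eq_mul, Finset.mul_sum]
          exact Finset.sum_congr rfl fun y _ => by ring
        have := (hp x₀).ne'
        rw [hlap, lap_smul, hχ]
        funext x
        rw [transportRate, hsource]
        simp only [Pi.smul_apply, smul_eq_mul, hf]
        field_simp
        ring
      have hsymm : ∀ x y, t * (1 - t) * p x₀ * k x y = t * (1 - t) * p x₀ * k y x := fun x y => by
        simp only [hk, hK.reversible x y]
      rw [hG]
      refine (kineticCost_anti (le_edgeWeight hK hc (hlow t ⟨ht0.le, ht1.le⟩)) _).trans ?_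
      refine (kineticCost_lap hsymm
        (fun x y => mul_nonneg hc.le (hK.mul_nonneg x y)) _).trans_le ?_
      refine ENNReal.ofReal_le_ofReal ?_
      have he : energy (fun x y => t * (1 - t) * p x₀ * k x y) χ =
          t * (1 - t) * p x₀ * energy k χ := by
        simp only [energy, Finset.mul_sum]
        exact Finset.sum_congr rfl fun x _ => Finset.sum_congr rfl fun y _ => by ring
      rw [energy_smul, he]
      have hq := hp x₀
      have : (6 / p x₀) ^ 2 * (t * (1 - t) * p x₀ * energy k χ) =
          t * (1 - t) * (36 / p x₀ * energy k χ) := by field_simp; ring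
      rw [this]
      exact mul_le_of_le_one_left (by positivity) ht3
  refine ne_top_of_le_ne_top ?_ (lintegral_mono_ae (g := fun _ =>
    ENNReal.ofReal (a ^ 2) * ENNReal.ofReal ((6 * |m| + 1) ^ 2) +
        ENNReal.ofReal (b ^ 2) * ENNReal.ofReal (36 / p x₀ * energy k χ)) ?_)
  · rw [lintegral_const]
    simp only [Measure.restrict_apply_univ, Real.volume_Icc]
    finiteness
  · rw [unitTime, ← restrict_Ioo_eq_restrict_Icc]
    filter_upwards [ae_restrict_mem measurableSet_Ioo] with t ht using hbound t ht

end Curves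

/-! ### Minimisation over nested convex sets in a Hilbert space -/

/-- From a decreasing sequence of bounded midpoint-convex sets one can select a Cauchy sequence:
by the parallelogram identity, elements of nearly minimal norm do. This strong convergence makes
weak compactness unnecessary. -/
lemma exists_cauchySeq_of_midpoint {H : Type*} [NormedAddCommGroup H] [InnerProductSpace ℝ H]
    {C : ℕ → Set H} (hanti : Antitone C) (hne : ∀ n, (C n).Nonempty)
    (hmid : ∀ n, ∀ v ∈ C n, ∀ w ∈ C n, (2⁻¹ : ℝ) • (v + w) ∈ C n) {R : ℝ}
    (hR : ∀ v ∈ C 0, ‖v‖ ≤ R) : ∃ w : ℕ → H, (∀ n, w n ∈ C n) ∧ CauchySeq w := by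
  set d : ℕ → ℝ := fun n => sInf ((fun v => ‖v‖ ^ 2) '' C n) with hd
  have hbdd : ∀ n, BddBelow ((fun v => ‖v‖ ^ 2) '' C n) := fun n =>
    ⟨0, by rintro _ ⟨v, -, rfl⟩; positivity⟩
  have hdle : ∀ n, ∀ v ∈ C n, d n ≤ ‖v‖ ^ 2 := fun n v hv => csInf_le (hbdd n) ⟨v, hv, rfl⟩
  have hmono : Monotone d := fun n m hnm =>
    csInf_le_csInf (hbdd n) ((hne m).image _) (image_mono (hanti hnm))
  have hub : ∀ n, d n ≤ R ^ 2 := fun n => by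
    obtain ⟨v, hv⟩ := hne n
    exact (hdle n v hv).trans (pow_le_pow_left₀ (norm_nonneg _) (hR v (hanti (Nat.zero_le n) hv)) 2)
  have hex : ∀ n : ℕ, ∃ v ∈ C n, ‖v‖ ^ 2 < d n + 1 / ((n : ℝ) + 1) := fun n => by
    obtain ⟨_, ⟨v, hv, rfl⟩, h⟩ := exists_lt_of_csInf_lt ((hne n).image (fun v => ‖v‖ ^ 2))
      (lt_add_of_pos_right (d n) (by positivity : (0 : ℝ) < 1 / ((n : ℝ) + 1)))
    exact ⟨v, hv, h⟩
  choose w hwC hw using hex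
  have hbd : BddAbove (range d) := ⟨R ^ 2, by rintro _ ⟨n, rfl⟩; exact hub n⟩
  have hlim := tendsto_atTop_ciSup hmono hbd
  refine ⟨w, hwC, cauchySeq_of_le_tendsto_0'
    (fun n : ℕ => Real.sqrt (2 * ((⨆ i, d i) - d n) + 4 * (1 / ((n : ℝ) + 1)))) ?_ ?_⟩
  · intro n m hnm
    rw [dist_eq_norm]
    apply Real.le_sqrt_of_sq_le
    have h1 := hdle n _ (hmid n _ (hwC n) _ (hanti hnm (hwC m)))
    rw [norm_smul, mul_pow] at h1
    norm_num at h1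
    have h2 := parallelogram_law_with_norm ℝ (w n) (w m)
    have h3 := hw n
    have h4 := hw m
    have h5 : d m ≤ ⨆ i, d i := le_ciSup hbd m
    have h6 : 1 / ((m : ℝ) + 1) ≤ 1 / ((n : ℝ) + 1) := by
      apply one_div_le_one_div_of_le (by positivity)
      exact_mod_cast Nat.succ_le_succ hnm
    nlinarith
  · have h1 : Tendsto (fun n : ℕ => 2 * ((⨆ i, d i) - d n) + 4 * (1 / ((n : ℝ) + 1))) atTop
        (𝓝 (2 * ((⨆ i, d i) - ⨆ i, d i) + 4 * 0)) :=
      ((tendsto_const_nhds.sub hlim).const_mul 2).add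
        (tendsto_one_div_add_atTop_nhds_zero_nat.const_mul 4)
    simpa using h1.sqrt

/-! ### Square-integrable velocities -/

section L2

variable {X : Type*} [Fintype X]

/-- The Hilbert space of square-integrable velocities. -/
abbrev VelocitySpace (X : Type*) [Fintype X] := Lp (EuclideanSpace ℝ X) 2 unitTime

/-- The coordinates of a representative of a square-integrable velocity. -/
def velocity (F : VelocitySpace X) (t : ℝ) (x : X) : ℝ := F t x

lemma measurable_velocity (F : VelocitySpace X) : Measurable (velocity F) :=
  measurable_pi_lambda _ fun x =>
    (EuclideanSpace.proj (𝕜 := ℝ) x).continuous.measurable.comp (Lp.stronglyMeasurable F).measurable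

lemma integrable_velocity (F : VelocitySpace X) (x : X) :
    Integrable (fun t => velocity F t x) unitTime :=
  (EuclideanSpace.proj (𝕜 := ℝ) x).integrable_comp ((Lp.memLp F).integrable one_le_two)

lemma norm_sq_eq_sum_integral (F : VelocitySpace X) :
    ‖F‖ ^ 2 = ∑ x, ∫ t, velocity F t x ^ 2 ∂unitTime := by
  have hint : ∀ x, Integrable (fun t => velocity F t x ^ 2) unitTime := fun x => by
    have h := ((EuclideanSpace.proj (𝕜 := ℝ) x).comp_memLp' (Lp.memLp F)).integrable_sq
    exact h
  rw [← integral_finsetSum _ fun x _ => hint x, ← real_inner_self_eq_norm_sq, L2.inner_def]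
  refine integral_congr_ae (Eventually.of_forall fun t => ?_)
  simp only [real_inner_self_eq_norm_sq, EuclideanSpace.real_norm_sq_eq, velocity]

lemma velocity_midpoint (F G : VelocitySpace X) : velocity ((2⁻¹ : ℝ) • (F + G)) =ᵐ[unitTime]
    fun t x => (velocity F t x + velocity G t x) / 2 := by
  filter_upwards [Lp.coeFn_smul (2⁻¹ : ℝ) (F + G), Lp.coeFn_add F G] with t h1 h2
  funext x
  rw [velocity, h1, Pi.smul_apply, h2]
  simp only [Pi.add_apply, PiLp.smul_apply, PiLp.add_apply, smul_eq_mul, velocity]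
  ring

lemma exists_velocity_ae_eq {f : ℝ → X → ℝ} (hf : Measurable f)
    (hfin : ∀ x, ∫⁻ t, ENNReal.ofReal (f t x ^ 2) ∂unitTime ≠ ∞) :
    ∃ F : VelocitySpace X, f =ᵐ[unitTime] velocity F := by
  have hfx : ∀ x, Measurable fun t => f t x := fun x => (measurable_pi_apply x).comp hf
  have hm : AEStronglyMeasurable (fun t => WithLp.toLp 2 (f t)) unitTime :=
    ((PiLp.continuous_toLp 2 _).measurable.comp hf).aestronglyMeasurable
  have hL : MemLp (fun t => WithLp.toLp 2 (f t)) 2 unitTime := by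
    rw [memLp_two_iff_integrable_sq_norm hm]
    simp only [EuclideanSpace.real_norm_sq_eq]
    refine integrable_finsetSum _ fun x _ => ⟨((hfx x).pow_const 2).aestronglyMeasurable, ?_⟩
    rw [hasFiniteIntegral_iff_ofReal (Eventually.of_forall fun t => sq_nonneg _)]
    exact (hfin x).lt_top
  refine ⟨hL.toLp _, ?_⟩
  filter_upwards [hL.coeFn_toLp] with t ht
  funext x
  rw [velocity, ht]

lemma norm_sq_le_of_lintegral_le {F : VelocitySpace X} {C : ℝ≥0∞} (hC : C ≠ ∞)
    (h : ∀ x, ∫⁻ t, ENNReal.ofReal (velocity F t x ^ 2) ∂unitTime ≤ C) :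
    ‖F‖ ^ 2 ≤ Fintype.card X * C.toReal := by
  rw [norm_sq_eq_sum_integral, ← nsmul_eq_mul]
  refine Finset.sum_le_card_nsmul _ _ _ fun x _ => ?_
  have hm : Measurable fun t => velocity F t x :=
    (measurable_pi_apply x).comp (measurable_velocity F)
  rw [integral_eq_lintegral_of_nonneg_ae (Eventually.of_forall fun t => sq_nonneg _)
    (hm.pow_const 2).aestronglyMeasurable]
  exact ENNReal.toReal_mono hC (h x)

variable {K : Matrix X X ℝ} {ϖ p : X → ℝ} {a b : ℝ} {μ₀ μ₁ : X → ℝ}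

lemma tendsto_curve_velocity {F : ℕ → VelocitySpace X} {F' : VelocitySpace X}
    (hF : Tendsto F atTop (𝓝 F')) (t : ℝ) :
    Tendsto (fun n => curve μ₀ (velocity (F n)) t) atTop (𝓝 (curve μ₀ (velocity F') t)) := by
  rw [tendsto_pi_nhds]
  intro x
  refine tendsto_const_nhds.add ?_
  have hL1 : Tendsto (fun n => ∫⁻ s, ‖velocity (F n) s x - velocity F' s x‖ₑ ∂unitTime) atTop
      (𝓝 0) := by
    have h0 : Tendsto (fun n => eLpNorm (F n - F' : VelocitySpace X) 2 unitTime) atTop (𝓝 0) := by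
      have h1 := (tendsto_iff_norm_sub_tendsto_zero.1 hF)
      have h2 := ENNReal.tendsto_ofReal h1
      rw [ENNReal.ofReal_zero] at h2
      refine h2.congr fun n => ?_
      rw [Lp.norm_def, ENNReal.ofReal_toReal (Lp.eLpNorm_ne_top _)]
    refine tendsto_of_tendsto_of_tendsto_of_le_of_le tendsto_const_nhds h0 (fun _ => zero_le) ?_
    intro n
    calc ∫⁻ s, ‖velocity (F n) s x - velocity F' s x‖ₑ ∂unitTime
        ≤ ∫⁻ s, ‖(F n - F' : VelocitySpace X) s‖ₑ ∂unitTime := by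
          refine lintegral_mono_ae ?_
          filter_upwards [Lp.coeFn_sub (F n) F'] with s hs
          rw [hs]
          exact enorm_le_iff_norm_le.2 (PiLp.norm_apply_le ((F n) s - F' s) x)
      _ = eLpNorm (F n - F' : VelocitySpace X) 1 unitTime := eLpNorm_one_eq_lintegral_enorm.symm
      _ ≤ eLpNorm (F n - F' : VelocitySpace X) 2 unitTime := by
          have : IsProbabilityMeasure unitTime := ⟨by simp⟩
          exact eLpNorm_le_eLpNorm_of_exponent_le one_le_two (Lp.aestronglyMeasurable _)
  have hset := fun s => tendsto_setIntegral_of_L1 (fun s => velocity F' s x)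
    (integrable_velocity F' x).1 (Eventually.of_forall fun n => integrable_velocity (F n) x) hL1 s
  exact (hset _).sub (hset _)

/-- Closedness and lower semicontinuity under strong convergence: the curves converge at every time
and the velocities, along a subsequence, at almost every time, so that Fatou's lemma applies. -/
lemma isVelocity_and_cost_le_of_tendsto {F : ℕ → VelocitySpace X} {F' : VelocitySpace X}
    (hF : Tendsto F atTop (𝓝 F')) (hvel : ∀ n, IsVelocity μ₀ μ₁ (velocity (F n)))
    {c : ℕ → ℝ≥0∞} {I : ℝ≥0∞} (hc : Tendsto c atTop (𝓝 I))
    (hcost : ∀ n, cost K ϖ p a b μ₀ (velocity (F n)) ≤ c n) :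
    IsVelocity μ₀ μ₁ (velocity F') ∧ cost K ϖ p a b μ₀ (velocity F') ≤ I := by
  have hcurve := tendsto_curve_velocity (μ₀ := μ₀) hF
  have hv : IsVelocity μ₀ μ₁ (velocity F') :=
    { measurable := measurable_velocity F'
      integrable := integrable_velocity F'
      mem_densities := fun t ht x => ge_of_tendsto' ((tendsto_pi_nhds.1 (hcurve t)) x)
        fun n => (hvel n).mem_densities t ht x
      finish := tendsto_nhds_unique (hcurve 1)
        (by simp only [(hvel _).finish, tendsto_const_nhds]) }
  refine ⟨hv, ?_⟩
  obtain ⟨ns, hns, hae⟩ := (tendstoInMeasure_of_tendsto_Lp hF).exists_seq_tendsto_ae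
  have hpt : ∀ᵐ t ∂unitTime, lagrangian K ϖ p a b (curve μ₀ (velocity F') t) (velocity F' t) ≤
      liminf (fun k => lagrangian K ϖ p a b (curve μ₀ (velocity (F (ns k))) t)
        (velocity (F (ns k)) t)) atTop := by
    filter_upwards [hae] with t ht
    have h1 : Tendsto (fun k => velocity (F (ns k)) t) atTop (𝓝 (velocity F' t)) :=
      ((PiLp.continuous_ofLp 2 _).tendsto _).comp ht
    have h2 := ((hcurve t).comp hns.tendsto_atTop).prodMk_nhds h1
    have h3 := lowerSemicontinuous_iff_le_liminf.1 (lowerSemicontinuous_lagrangian (K := K)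
      (ϖ := ϖ) (p := p) (a := a) (b := b)) (curve μ₀ (velocity F') t, velocity F' t)
    refine h3.trans ?_
    have h4 := Filter.liminf_le_liminf_of_le (f := 𝓝 (curve μ₀ (velocity F') t, velocity F' t)) h2
      (u := fun q : (X → ℝ) × (X → ℝ) => lagrangian K ϖ p a b q.1 q.2)
    exact h4
  calc cost K ϖ p a b μ₀ (velocity F')
      ≤ ∫⁻ t, liminf (fun k => lagrangian K ϖ p a b (curve μ₀ (velocity (F (ns k))) t)
        (velocity (F (ns k)) t)) atTop ∂unitTime := lintegral_mono_ae hpt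
    _ ≤ liminf (fun k => cost K ϖ p a b μ₀ (velocity (F (ns k)))) atTop :=
        lintegral_liminf_le fun k => (hvel (ns k)).measurable_lagrangian_curve
    _ ≤ liminf (fun k => c (ns k)) atTop := liminf_le_liminf (Eventually.of_forall fun k => hcost _)
    _ = I := (hc.comp hns.tendsto_atTop).liminf_eq

/-- Attainment of any finite level approached from above by the costs of velocities. -/
lemma exists_velocity_cost_le (hK : IsReversibleChain K ϖ) (ha : 0 < a) (hb : 0 < b)
    (h₀ : μ₀ ∈ densities X) {I : ℝ≥0∞} (hI : I ≠ ∞)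
    (happ : ∀ c, I < c → ∃ f, IsVelocity μ₀ μ₁ f ∧ cost K ϖ p a b μ₀ f ≤ c) :
    ∃ f, IsVelocity μ₀ μ₁ f ∧ cost K ϖ p a b μ₀ f ≤ I := by
  set c : ℕ → ℝ≥0∞ := fun n => I + ENNReal.ofReal (1 / ((n : ℝ) + 1)) with hc
  have hc_top : ∀ n, c n ≠ ∞ := fun n => ENNReal.add_ne_top.2 ⟨hI, ENNReal.ofReal_ne_top⟩
  have hc_lim : Tendsto c atTop (𝓝 I) := by
    have := (ENNReal.tendsto_ofReal tendsto_one_div_add_atTop_nhds_zero_nat).const_add I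
    rwa [ENNReal.ofReal_zero, add_zero] at this
  have hc_anti : Antitone c := fun n m hnm => by
    refine add_le_add le_rfl (ENNReal.ofReal_le_ofReal
      (one_div_le_one_div_of_le (by positivity) ?_))
    exact_mod_cast Nat.succ_le_succ hnm
  set S : ℕ → Set (VelocitySpace X) := fun n =>
    {F | IsVelocity μ₀ μ₁ (velocity F) ∧ cost K ϖ p a b μ₀ (velocity F) ≤ c n} with hS
  obtain ⟨C, hC, hbound⟩ := exists_lintegral_sq_le (p := p) (μ₁ := μ₁) hK ha hb h₀ (hc_top 0)
  obtain ⟨w, hw, hcau⟩ := exists_cauchySeq_of_midpoint (C := S)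
    (fun n m hnm F hF => ⟨hF.1, hF.2.trans (hc_anti hnm)⟩)
    (fun n => by
      obtain ⟨f, hf, hfc⟩ := happ (c n) (ENNReal.lt_add_right hI (by
        rw [Ne, ENNReal.ofReal_eq_zero, not_le]; positivity))
      obtain ⟨F, hF⟩ := exists_velocity_ae_eq hf.measurable fun x =>
        ne_top_of_le_ne_top hC (hbound f hf (hfc.trans (hc_anti (Nat.zero_le n))) x)
      exact ⟨F, hf.congr (measurable_velocity F) hF, (cost_congr hF).symm.trans_le hfc⟩)
    (by
      rintro n F ⟨hF, hFc⟩ G ⟨hG, hGc⟩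
      have hae := (velocity_midpoint F G).symm
      refine ⟨(hF.midpoint hG).congr (measurable_velocity _) hae, ?_⟩
      rw [← cost_congr hae]
      refine (hF.cost_midpoint hK hG).trans ?_
      refine ENNReal.div_le_of_le_mul ?_
      rw [mul_two]
      exact add_le_add hFc hGc)
    (R := Real.sqrt (Fintype.card X * C.toReal)) (by
      rintro F ⟨hF, hFc⟩
      exact Real.le_sqrt_of_sq_le (norm_sq_le_of_lintegral_le hC (hbound _ hF hFc)))
  obtain ⟨F', hF'⟩ := cauchySeq_tendsto_of_complete hcau
  exact ⟨_, isVelocity_and_cost_le_of_tendsto hF' (fun n => (hw n).1) hc_lim fun n => (hw n).2⟩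

/-- The infimum of the action over the admissible triples is finite and attained. -/
lemma exists_isAdmissible_action_eq_iInf (hK : IsReversibleChain K ϖ) (ha : 0 < a) (hb : 0 < b)
    (hp : p ∈ posDensities X) (hp1 : mass ϖ p = 1) (h₀ : μ₀ ∈ densities X)
    (h₁ : μ₁ ∈ densities X) {I : ℝ≥0∞} (hI : I = ⨅ (μ : ℝ → X → ℝ) (ψ : ℝ → X → ℝ) (h : ℝ → ℝ)
      (_ : IsAdmissible K p μ₀ μ₁ μ ψ h), action K ϖ a b μ ψ h) :
    I ≠ ∞ ∧ ∃ μ ψ h, IsAdmissible K p μ₀ μ₁ μ ψ h ∧ action K ϖ a b μ ψ h = I := by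
  have hle : ∀ μ ψ h, IsAdmissible K p μ₀ μ₁ μ ψ h → I ≤ action K ϖ a b μ ψ h :=
    fun μ ψ h H => hI.trans_le
      (iInf_le_of_le μ (iInf_le_of_le ψ (iInf_le_of_le h (iInf_le _ H))))
  have hItop : I ≠ ∞ := by
    obtain ⟨f, hf, hfin⟩ := exists_velocity_cost_ne_top (a := a) (b := b) hK hp hp1 h₀ h₁
    obtain ⟨μ, ψ, h, H, hact⟩ := hf.exists_admissible hK hb hp hp1 hfin
    exact ne_top_of_le_ne_top (hact ▸ hfin) (hle μ ψ h H)
  refine ⟨hItop, ?_⟩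
  obtain ⟨f, hf, hfI⟩ := exists_velocity_cost_le hK ha hb h₀ (p := p) (μ₁ := μ₁) hItop (by
    intro c hc
    simp only [hI, iInf_lt_iff] at hc
    obtain ⟨μ, ψ, h, H, hact⟩ := hc
    obtain ⟨f, hf, hfc⟩ := H.exists_velocity (ϖ := ϖ) (a := a) (b := b) hK hp hp1
    exact ⟨f, hf, hfc.trans_le hact.le⟩)
  obtain ⟨μ, ψ, h, H, hact⟩ := hf.exists_admissible hK hb hp hp1 (ne_top_of_le_ne_top hItop hfI)
  exact ⟨μ, ψ, h, H, le_antisymm (hact.trans_le hfI) (hle μ ψ h H)⟩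

end L2

end MarkovTransport

end

theorem mainTheorem10 {X : Type*} [Fintype X] (K : Matrix X X ℝ) (ϖ : X → ℝ)
    (hK : MarkovTransport.IsReversibleChain K ϖ)
    (a b : ℝ) (ha : 0 < a) (hb : 0 < b)
    (p : X → ℝ) (hp : p ∈ MarkovTransport.posDensities X) (hp1 : MarkovTransport.mass ϖ p = 1)
    (μ₀ μ₁ : X → ℝ) (h₀ : μ₀ ∈ MarkovTransport.densities X)
    (h₁ : μ₁ ∈ MarkovTransport.densities X) :
    MarkovTransport.dist K ϖ p a b μ₀ μ₁ ≠ ∞ ∧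
      ∃ (μ ψ : ℝ → X → ℝ) (h : ℝ → ℝ),
        MarkovTransport.IsAdmissible K p μ₀ μ₁ μ ψ h ∧
          MarkovTransport.action K ϖ a b μ ψ h = MarkovTransport.dist K ϖ p a b μ₀ μ₁ ^ 2 := by
  obtain ⟨hfin, μ, ψ, h, H, hact⟩ :=
    MarkovTransport.exists_isAdmissible_action_eq_iInf hK ha hb hp hp1 h₀ h₁ rfl
  refine ⟨ENNReal.rpow_ne_top_of_nonneg (by norm_num) hfin, μ, ψ, h, H, ?_⟩
  rw [hact, MarkovTransport.dist, ← ENNReal.rpow_natCast, ← ENNReal.rpow_mul]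
  norm_num
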